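/- Let $k$ be an algebraically closed field, let $d, m, n \ge 2$ be integers with $\gcd(m,n)=1$ and $mn$ invertible in $k$, and let $a,b\ge 1$ be integers with $a+b=n$. Put $$A = k[X,Y,Z,W_3,\ldots,W_d]\big/\Big(X^n+Y^m+X^aZ^b+\sum_{j=3}^{d}W_j^n\Big)$$ (so there are no variables $W_j$ if $d=2$), graded by $\deg X=\deg Z=\deg W_3=\cdots=\deg W_d=m$ and $\deg Y=n$, and let $T=k[X,Z,W_3,\ldots,W_d]\subseteq A$. For a module $M$ over a ring $B$, $\operatorname{Ass}^{(i)}_B(M)$ denotes the set of associated primes of $M$ of height $i$. Then $A$ is a Cohen–Macaulay domain, and the following hold. 1. $A$ is a finitely generated graded $k$-algebra with $A_0=k$ and $\dim A=d$; $T$ is a Noether normalization of $A$ (that is, $X,Z,W_3,\ldots,W_d$ are algebraically independent over $k$ in $A$ and $A$ is a finite $T$-module) whose $d$ generators are homogeneous of degree $m$; and for every $T$-regular sequence $u_1,\ldots,u_{d-1}\in T_m$ one has $\sharp\operatorname{Ass}^{(d-1)}_A A/(u_1,\ldots,u_{d-1})A=1$. 2. If $d=2$, then $\sharp\operatorname{Ass}^{(1)}_A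 A/\xi A=1$ for every nonzero $\xi\in T_m$. 3. Let $R$ be a graded ring with inclusions of graded rings $T\subseteq R\subseteq A$. If $\operatorname{grade}(T_+,R)\ge d-1$, then the first graded Chow group $A_1^*(R)$ is a torsion group. If $d=2$, then (without any condition on the grade) the first Chow group $A_1(R)$ is a torsion group. Here, for a finitely generated $k$-algebra $R$, $Z_i(R)$ is the free abelian group on the symbols $[R/P]$ with $P$ a prime ideal and $\dim R/P=i$. For a prime $Q$ with $\dim R/Q=i+1$ and $x\in R\setminus Q$ put $\operatorname{div}(Q,x)=\sum_{\dim R/P=i}\operatorname{length}_{R_P}\big((R/(Q+xR))_P\big)\,[R/P]$; then $A_i(R)$ is the quotient of $Z_i(R)$ by the subgroup generated by all such $\operatorname{div}(Q,x)$. If $R$ is graded, $A_i^*(R)$ is defined in the same way using only homogeneous primes $P$, $Q$ and homogeneous elements $x$. -/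

import Mathlib

open MvPolynomial

noncomputable section

namespace GradedChow

/-! ### Grade, Cohen-Macaulay rings, associated primes of given height -/

/-- `grade(I, M)`: the supremum of the lengths of `M`-regular sequences contained in `I`. -/
def grade {R : Type*} [CommRing R] (I : Ideal R) (M : Type*) [AddCommGroup M] [Module R M] : ℕ∞ :=
  ⨆ rs : {rs : List R // (∀ r ∈ rs, r ∈ I) ∧ RingTheory.Sequence.IsRegular M rs},
    (rs.1.length : ℕ∞)

/-- The depth of a local ring equals its Krull dimension. -/
def IsCohenMacaulayLocal (R : Type*) [CommRing R] [IsLocalRing R] : Prop :=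
  IsNoetherianRing R ∧ (grade (IsLocalRing.maximalIdeal R) R : WithBot ℕ∞) = ringKrullDim R

/-- A Noetherian ring all of whose localizations at maximal ideals are Cohen-Macaulay. -/
def IsCohenMacaulay (R : Type*) [CommRing R] : Prop :=
  IsNoetherianRing R ∧
    ∀ (P : Ideal R) [P.IsMaximal], IsCohenMacaulayLocal (Localization.AtPrime P)

/-- `Ass^{(i)}_A(M)`: the associated primes of `M` that have height `i` (as primes of `A`). -/
def assHeight (A : Type*) [CommRing A] (i : ℕ) (M : Type*) [AddCommGroup M] [Module A M] :
    Set (Ideal A) :=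
  {P | P ∈ associatedPrimes A M ∧ P.height = (i : ℕ∞)}

/-! ### Chow groups

These are the Chow groups of finitely generated algebras over a field, where the dimension
function on primes is `P ↦ dim A/P` (Krull dimension). -/

/-- The length of `M_P` as an `A_P`-module. It is finite for all pairs that enter the cycles
below when `A` is Noetherian (then `P` is minimal in the support of `M`, or `M_P = 0`). -/
def lengthAt {A : Type*} [CommRing A] (M : Type*) [AddCommGroup M] [Module A M]
    (P : PrimeSpectrum A) : ℕ :=
  (Module.length (Localization.AtPrime P.asIdeal)
    (LocalizedModule P.asIdeal.primeCompl M)).toNat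

/-- The primes `P` of `A` with `dim A/P = i`. -/
abbrev PrimesOfDim (A : Type*) [CommRing A] (i : ℕ) : Type _ :=
  {P : PrimeSpectrum A // ringKrullDim (A ⧸ P.asIdeal) = ((i : ℕ∞) : WithBot ℕ∞)}

/-- `Z_i(A)`: the free abelian group on the classes `[A/P]` with `dim A/P = i`. -/
abbrev Cycles (A : Type*) [CommRing A] (i : ℕ) : Type _ := PrimesOfDim A i →₀ ℤ

/-- `[M]_i = ∑_{dim A/P = i} length(M_P) [A/P]`. -/
def cycleOf {A : Type*} [CommRing A] (i : ℕ) (M : Type*) [AddCommGroup M] [Module A M] :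
    Cycles A i :=
  ∑ᶠ P : PrimesOfDim A i, Finsupp.single P (lengthAt M P.1 : ℤ)

/-- The subgroup of `Z_i(A)` generated by `div(Q, x) = [(A/Q)/x(A/Q)]_i`, for primes `Q` with
`dim A/Q = i + 1` and `x ∉ Q`. -/
def ratEquiv (A : Type*) [CommRing A] (i : ℕ) : AddSubgroup (Cycles A i) :=
  AddSubgroup.closure
    {z | ∃ (Q : PrimesOfDim A (i + 1)) (x : A), x ∉ Q.1.asIdeal ∧
      z = cycleOf i (A ⧸ (Q.1.asIdeal ⊔ Ideal.span {x}))}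

/-- The Chow group `A_i(A)`. -/
abbrev ChowGroup (A : Type*) [CommRing A] (i : ℕ) : Type _ := Cycles A i ⧸ ratEquiv A i

section graded

variable {k A : Type*} [Field k] [CommRing A] [Algebra k A]

/-- The homogeneous primes `P` of `A` with `dim A/P = i`. -/
abbrev HomPrimesOfDim (𝒜 : ℕ → Submodule k A) [GradedAlgebra 𝒜] (i : ℕ) : Type _ :=
  {P : PrimeSpectrum A // P.asIdeal.IsHomogeneous 𝒜 ∧
    ringKrullDim (A ⧸ P.asIdeal) = ((i : ℕ∞) : WithBot ℕ∞)}

/-- `Z_i^*(A)`: the free abelian group on the `[A/P]` with `P` homogeneous and `dim A/P = i`. -/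
abbrev GradedCycles (𝒜 : ℕ → Submodule k A) [GradedAlgebra 𝒜] (i : ℕ) : Type _ :=
  HomPrimesOfDim 𝒜 i →₀ ℤ

/-- `[M]_i` as an element of `Z_i^*(A)`, for modules `M` such that the primes `P` in the support
of `M` with `dim A/P = i` are homogeneous. -/
def gradedCycleOf (𝒜 : ℕ → Submodule k A) [GradedAlgebra 𝒜] (i : ℕ)
    (M : Type*) [AddCommGroup M] [Module A M] : GradedCycles 𝒜 i :=
  ∑ᶠ P : HomPrimesOfDim 𝒜 i, Finsupp.single P (lengthAt M P.1 : ℤ)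

/-- The subgroup of `Z_i^*(A)` generated by `div(Q, x)`, for homogeneous primes `Q` with
`dim A/Q = i + 1` and homogeneous `x ∉ Q`. -/
def gradedRatEquiv (𝒜 : ℕ → Submodule k A) [GradedAlgebra 𝒜] (i : ℕ) :
    AddSubgroup (GradedCycles 𝒜 i) :=
  AddSubgroup.closure
    {z | ∃ (Q : HomPrimesOfDim 𝒜 (i + 1)) (x : A), SetLike.IsHomogeneousElem 𝒜 x ∧
      x ∉ Q.1.asIdeal ∧ z = gradedCycleOf 𝒜 i (A ⧸ (Q.1.asIdeal ⊔ Ideal.span {x}))}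

/-- The graded Chow group `A_i^*(A)`. -/
abbrev GradedChowGroup (𝒜 : ℕ → Submodule k A) [GradedAlgebra 𝒜] (i : ℕ) : Type _ :=
  GradedCycles 𝒜 i ⧸ gradedRatEquiv 𝒜 i

/-! ### Graded Noether normalizations and the hypotheses on `A` -/

/-- The `k`-subalgebra `T = k[x_1, …, x_d]` of `A`. -/
abbrev subalg (k : Type*) {A : Type*} [Field k] [CommRing A] [Algebra k A] {d : ℕ}
    (x : Fin d → A) : Subalgebra k A :=
  Algebra.adjoin k (Set.range x)

/-- `T = k[x_1, …, x_d]` is a Noether normalization of `A` with all `x_i` homogeneous of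
degree `m`. -/
structure IsNoetherNormalization (𝒜 : ℕ → Submodule k A) {d : ℕ} (x : Fin d → A) (m : ℕ) :
    Prop where
  algebraicIndependent : AlgebraicIndependent k x
  finite : Module.Finite (subalg k x) A
  degree : ∀ i, x i ∈ 𝒜 m

/-- The hypotheses of the two-dimensional theorem: `A` is a finitely generated graded domain of
dimension `2` over `k = A_0`, `T = k[x_1, x_2]` is a Noether normalization with
`deg x_1 = deg x_2 = m`, and `♯ Ass^{(1)}_A(A/ξA) = 1` for every non-zero `ξ ∈ T_m`. -/
structure HypDimTwo (𝒜 : ℕ → Submodule k A) [GradedAlgebra 𝒜] (x : Fin 2 → A) (m : ℕ) :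
    Prop where
  isDomain : IsDomain A
  finiteType : Algebra.FiniteType k A
  degree_zero : ∀ r : A, r ∈ 𝒜 0 ↔ ∃ c : k, algebraMap k A c = r
  dim : ringKrullDim A = 2
  normalization : IsNoetherNormalization 𝒜 x m
  ass : ∀ ξ ∈ subalg k x, ξ ∈ 𝒜 m → ξ ≠ 0 →
    (assHeight A 1 (A ⧸ Ideal.span {ξ})).encard = 1

/-- The hypotheses of the `d`-dimensional theorem: `A` is a finitely generated graded algebra over
`k = A_0`, Cohen-Macaulay of dimension `d ≥ 2`, `T = k[x_1, …, x_d]` is a Noether normalization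
with `deg x_1 = ⋯ = deg x_d = m`, and `♯ Ass^{(d-1)}_A(A/(u_1, …, u_{d-1})A) = 1` for every
`T`-regular sequence `u_1, …, u_{d-1}` in `T_m`. -/
structure HypDimD (𝒜 : ℕ → Submodule k A) [GradedAlgebra 𝒜] {d : ℕ} (x : Fin d → A) (m : ℕ) :
    Prop where
  finiteType : Algebra.FiniteType k A
  degree_zero : ∀ r : A, r ∈ 𝒜 0 ↔ ∃ c : k, algebraMap k A c = r
  two_le : 2 ≤ d
  dim : ringKrullDim A = ((d : ℕ∞) : WithBot ℕ∞)
  cohenMacaulay : IsCohenMacaulay A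
  normalization : IsNoetherNormalization 𝒜 x m
  ass : ∀ us : List (subalg k x), us.length = d - 1 → (∀ u ∈ us, (u : A) ∈ 𝒜 m) →
    RingTheory.Sequence.IsRegular (subalg k x) us →
    (assHeight A (d - 1)
      (A ⧸ Ideal.ofList (us.map (fun u : subalg k x => (u : A))))).encard = 1

/-- `T_+`: the ideal of the graded subalgebra `T` of `A` generated by the homogeneous elements of
positive degree. -/
def irrelevantIdeal (𝒜 : ℕ → Submodule k A) (T : Subalgebra k A) : Ideal T :=
  Ideal.span {t : T | ∃ i : ℕ, 0 < i ∧ (t : A) ∈ 𝒜 i}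

/-- `grade(T_+, R)` for subalgebras `T ⊆ R` of `A`, where `R` is a `T`-module by the inclusion. -/
def gradeIrrelevant (𝒜 : ℕ → Submodule k A) {T R : Subalgebra k A} (h : T ≤ R) : ℕ∞ :=
  letI : Module T R := Module.compHom R (Subalgebra.inclusion h).toRingHom
  grade (irrelevantIdeal 𝒜 T) R

end graded

/-! ### The hypersurface

The variables are `X 0 = X`, `X 1 = Y`, `X 2 = Z` and `X j = W_j` for `3 ≤ j ≤ d`
(all in use when `d ≥ 2`). -/

/-- `X^n + Y^m + X^a Z^b + ∑_{j=3}^d W_j^n`. -/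
def hyperPoly (k : Type*) [Field k] (d m n a b : ℕ) : MvPolynomial (Fin (d + 1)) k :=
  X 0 ^ n + X 1 ^ m + X 0 ^ a * X 2 ^ b +
    ∑ j ∈ Finset.univ.filter (fun j : Fin (d + 1) => 3 ≤ (j : ℕ)), X j ^ n

/-- `A = k[X, Y, Z, W_3, …, W_d]/(X^n + Y^m + X^a Z^b + ∑_{j=3}^d W_j^n)`. -/
abbrev HyperRing (k : Type*) [Field k] (d m n a b : ℕ) : Type _ :=
  MvPolynomial (Fin (d + 1)) k ⧸ Ideal.span {hyperPoly k d m n a b}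

/-- `deg Y = n`, and all the other variables have degree `m`. -/
def hyperWeight (d m n : ℕ) (j : Fin (d + 1)) : ℕ := if j = 1 then n else m

/-- The grading of `A` induced by the weights of the variables. -/
def hyperGrading (k : Type*) [Field k] (d m n a b : ℕ) (i : ℕ) :
    Submodule k (HyperRing k d m n a b) :=
  (weightedHomogeneousSubmodule k (hyperWeight d m n) i).map
    (Ideal.Quotient.mkₐ k (Ideal.span {hyperPoly k d m n a b})).toLinearMap

/-- The images in `A` of the `d` variables `X, Z, W_3, …, W_d` (all but `Y`), in this order. -/
def hyperParam (k : Type*) [Field k] (d m n a b : ℕ) (i : Fin d) : HyperRing k d m n a b :=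
  Ideal.Quotient.mk _ (X ((1 : Fin (d + 1)).succAbove i))

end GradedChow

end

/-! Let `B` be the polynomial ring in all variables but `Y`. Then `A = B[Y]/(Y^m + g)` with `g`
homogeneous of degree `n`, so `A` is free over `B`; this yields the Noether normalization, the
dimension and the Cohen–Macaulay property.

The key fact is that exactly one prime of `A` lies over the ideal of each line `k·v` through the
origin, and every prime containing that ideal contains it
(`exists_minimal_over_lineIdeal_adjoinRoot`). Restricting to the line with coordinate `t` gives
`k[t][Y]/(Y^m + g(v) t^n)`. If `g(v) ≠ 0`, then `gcd(m,n) = 1` makes this the ring of a monomial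
curve `t = s^m`, `Y = β s^n`, a domain; if `g(v) = 0`, then `Y` is nilpotent and the quotient by it
is `k[t]`. The first case, for one suitable `v`, also shows that `A` is a domain.

A regular sequence of `d - 1` linear forms generates the ideal of a line, so the key fact gives the
count of associated primes (`encard_assHeight_eq_one`).

By lying over, uniqueness descends to every ring `R` between `T` and `A`
(`eq_of_comap_eq_lineIdeal`). A homogeneous prime `P` of `R` with `dim R/P = 1` lies over a line.
Choose a plane through the line, a homogeneous prime `Q` over the plane, and a linear form `x`
cutting out the line in the plane: `P` is the only one-dimensional prime containing `Q + (x)`, so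
`div(Q, x)` is a nonzero multiple of `[R/P]` (`exists_homogeneous_prime_and_element`).

When `d = 2` and `P` is not homogeneous, an element `f ∈ P` whose degrees spread as little as
possible satisfies `hP ⊆ (f)` for some nonzero homogeneous `h` (`exists_mul_mem_span_singleton`).
All other one-dimensional primes containing `f` then contain `h` and are homogeneous, so `div(0, f)`
expresses a positive multiple of `[R/P]` through torsion classes. -/

namespace GradedChow

/-! ### Krull dimension of integral extensions and of quotients. -/

section Dimension

/-- Incomparability bounds the dimension of `S` from above; lying over and going up lift every chain
of primes of `R`, which bounds it from below. -/
theorem ringKrullDim_eq_of_isIntegral {R S : Type*} [CommRing R] [CommRing S] [Algebra R S]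
    [Algebra.IsIntegral R S] (h : Function.Injective (algebraMap R S)) :
    ringKrullDim S = ringKrullDim R := by
  refine le_antisymm (Order.krullDim_le_of_strictMono (PrimeSpectrum.comap (algebraMap R S))
    fun p q hpq => Ideal.IsIntegral.comap_lt_comap (R := R) hpq) ?_
  refine iSup_le fun l => ?_
  obtain ⟨P, -, hP, hPl⟩ := Ideal.exists_ideal_over_prime_of_isIntegral l.head.asIdeal
    (⊥ : Ideal S) (by
      rw [← RingHom.ker_eq_comap_bot, (RingHom.injective_iff_ker_eq_bot _).mp h]
      exact bot_le)
  have : P.LiesOver l.head.asIdeal := ⟨hPl.symm⟩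
  obtain ⟨L, hL, -, -⟩ := Ideal.exists_ltSeries_of_hasGoingUp (S := S) l P
  rw [← hL]
  exact le_iSup (fun L : LTSeries (PrimeSpectrum S) => ((L.length : ℕ∞) : WithBot ℕ∞)) L

theorem ringKrullDim_quotient_comap {R S : Type*} [CommRing R] [CommRing S] [Algebra R S]
    [Algebra.IsIntegral R S] (P : Ideal S) :
    ringKrullDim (S ⧸ P) = ringKrullDim (R ⧸ P.comap (algebraMap R S)) :=
  ringKrullDim_eq_of_isIntegral (R := R ⧸ P.comap (algebraMap R S)) (S := S ⧸ P)
    Ideal.algebraMap_quotient_injective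

theorem ringKrullDim_quotient_ker {R S : Type*} [CommRing R] [CommRing S] (f : R →+* S)
    (hf : Function.Surjective f) : ringKrullDim (R ⧸ RingHom.ker f) = ringKrullDim S :=
  ringKrullDim_eq_of_ringEquiv (RingHom.quotientKerEquivOfSurjective hf)

/-- An element of `q` outside `p` is a nonzerodivisor of the domain `R/p`, so dividing by it lowers
the dimension, and `R/q` is a further quotient. -/
theorem ringKrullDim_quotient_add_one_le {R : Type*} [CommRing R] {p q : Ideal R} [p.IsPrime]
    (h : p < q) : ringKrullDim (R ⧸ q) + 1 ≤ ringKrullDim (R ⧸ p) := by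
  obtain ⟨hle, x, hxq, hxp⟩ := SetLike.lt_iff_le_and_exists.mp h
  have hx : Ideal.Quotient.mk p x ≠ 0 := by rwa [Ne, Ideal.Quotient.eq_zero_iff_mem]
  refine le_trans ?_ (ringKrullDim_quotient_succ_le_of_nonZeroDivisor
    (mem_nonZeroDivisors_of_ne_zero hx))
  gcongr
  refine ringKrullDim_le_of_surjective (Ideal.Quotient.lift (Ideal.span {Ideal.Quotient.mk p x})
    (Ideal.Quotient.factor hle) ?_) ?_
  · intro a ha
    have : Ideal.span {Ideal.Quotient.mk p x} ≤ RingHom.ker (Ideal.Quotient.factor hle) := by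
      rw [Ideal.span_singleton_le_iff_mem, RingHom.mem_ker, Ideal.Quotient.factor_mk]
      exact Ideal.Quotient.eq_zero_iff_mem.mpr hxq
    exact this ha
  · exact Ideal.Quotient.lift_surjective_of_surjective _ _ (Ideal.Quotient.factor_surjective hle)

theorem eq_of_le_of_ringKrullDim_quotient {R : Type*} [CommRing R] {p q : Ideal R} [p.IsPrime]
    (h : p ≤ q) {n : ℕ} (hp : ringKrullDim (R ⧸ p) = ((n : ℕ∞) : WithBot ℕ∞))
    (hq : ringKrullDim (R ⧸ q) = ((n : ℕ∞) : WithBot ℕ∞)) : p = q := by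
  by_contra hne
  have := ringKrullDim_quotient_add_one_le (lt_of_le_of_ne h hne)
  rw [hp, hq] at this
  have h2 : ((n + 1 : ℕ) : WithBot ℕ∞) ≤ ((n : ℕ) : WithBot ℕ∞) := by exact_mod_cast this
  have h3 : n + 1 ≤ n := by exact_mod_cast h2
  omega

end Dimension

/-! ### Local lengths entering the cycles. -/

section Length

variable {A : Type*} [CommRing A]

theorem lengthAt_eq_zero (I : Ideal A) (P : PrimeSpectrum A) (h : ¬ I ≤ P.asIdeal) :
    lengthAt (A ⧸ I) P = 0 := by
  obtain ⟨x, hxI, hxP⟩ := SetLike.not_le_iff_exists.mp h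
  have : Subsingleton (LocalizedModule P.asIdeal.primeCompl (A ⧸ I)) := by
    rw [LocalizedModule.subsingleton_iff]
    intro m
    refine ⟨x, hxP, ?_⟩
    obtain ⟨m, rfl⟩ := Ideal.Quotient.mk_surjective m
    rw [Algebra.smul_def, Ideal.Quotient.algebraMap_eq, ← map_mul]
    exact Ideal.Quotient.eq_zero_iff_mem.mpr (I.mul_mem_right _ hxI)
  rw [lengthAt, Module.length_eq_zero]
  rfl

/-- Since `ENat.toNat` sends `⊤` to `0`, finiteness is needed besides nonvanishing. It holds because
`A_P/IA_P` is Artinian for `P` minimal over `I` and maps onto `(A/I)_P`. -/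
theorem lengthAt_ne_zero [IsNoetherianRing A] (I : Ideal A) (P : PrimeSpectrum A)
    (h : P.asIdeal ∈ I.minimalPrimes) : lengthAt (A ⧸ I) P ≠ 0 := by
  set S := P.asIdeal.primeCompl
  set L := Localization.AtPrime P.asIdeal
  set M := LocalizedModule S (A ⧸ I)
  have hart : IsArtinianRing (L ⧸ I.map (algebraMap A L)) := by
    have : IsNoetherianRing L := IsLocalization.isNoetherianRing S L inferInstance
    refine IsLocalRing.quotient_artinian_of_mem_minimalPrimes_of_isLocalRing _ ?_
    rwa [IsLocalization.minimalPrimes_map P.asIdeal.primeCompl L I, Set.mem_preimage,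
      Localization.AtPrime.under_maximalIdeal]
  have : IsNoetherianRing L := IsLocalization.isNoetherianRing S L inferInstance
  have : IsArtinian L (L ⧸ I.map (algebraMap A L)) := isArtinian_of_surjective_algebraMap
    (S := L) (R := L ⧸ I.map (algebraMap A L)) (M := L ⧸ I.map (algebraMap A L))
    Ideal.Quotient.mk_surjective
  let e : M := LocalizedModule.mk 1 1
  have hker : I.map (algebraMap A L) ≤ LinearMap.ker (LinearMap.toSpanSingleton L M e) := by
    rw [Ideal.map_le_iff_le_comap]
    intro a ha
    rw [Ideal.mem_comap, LinearMap.mem_ker, LinearMap.toSpanSingleton_apply, algebraMap_smul,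
      LocalizedModule.smul'_mk]
    have : a • (1 : A ⧸ I) = 0 := by
      rw [Algebra.smul_def, mul_one]
      exact Ideal.Quotient.eq_zero_iff_mem.mpr ha
    rw [this, LocalizedModule.zero_mk]
  let f : (L ⧸ I.map (algebraMap A L)) →ₗ[L] M :=
    Submodule.liftQ (I.map (algebraMap A L)) (LinearMap.toSpanSingleton L M e) hker
  have hf : Function.Surjective f := by
    intro z
    induction z using LocalizedModule.induction_on with
    | h m s =>
      obtain ⟨m, rfl⟩ := Ideal.Quotient.mk_surjective m
      refine ⟨Submodule.Quotient.mk (Localization.mk m s), ?_⟩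
      change Localization.mk m s • e = _
      rw [LocalizedModule.mk_smul_mk, mul_one]
      congr 1
      rw [Algebra.smul_def, mul_one]
      rfl
  have : IsArtinian L M := isArtinian_of_surjective _ f hf
  have : IsNoetherian L M := isNoetherian_of_surjective f (LinearMap.range_eq_top.mpr hf)
  have hnt : Nontrivial M := by
    rw [← not_subsingleton_iff_nontrivial, LocalizedModule.subsingleton_iff]
    intro hs
    obtain ⟨r, hr, hr1⟩ := hs 1
    apply hr
    apply h.1.2
    rw [Algebra.smul_def, mul_one] at hr1
    exact Ideal.Quotient.eq_zero_iff_mem.mp hr1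
  have h1 : Module.length L M ≠ 0 := Module.length_pos.ne'
  have h2 : Module.length L M ≠ ⊤ := Module.length_ne_top
  rw [lengthAt]
  intro h0
  rcases ENat.toNat_eq_zero.mp h0 with h | h
  · exact h1 h
  · exact h2 h

end Length

/-! ### Kernels of substitutions and the regular sequence defining a point. -/

section RegularSequence

/-- Modulo `J`, the composite `s ∘ θ` is the identity on variables, hence everywhere; so `θ f = 0`
forces `f ∈ J`. In the applications `s` is a section of `θ`. -/
theorem ker_le_of_sub_mem {k σ B : Type*} [CommRing k] [CommRing B] [Algebra k B]
    (θ : MvPolynomial σ k →ₐ[k] B) (s : B →ₐ[k] MvPolynomial σ k) (J : Ideal (MvPolynomial σ k))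
    (h : ∀ i, X i - s (θ (X i)) ∈ J) : RingHom.ker θ ≤ J := by
  have key : (Ideal.Quotient.mkₐ k J).comp (s.comp θ) = Ideal.Quotient.mkₐ k J := by
    ext i
    simpa using (Ideal.Quotient.mk_eq_mk_iff_sub_mem _ _).mpr (h i) |>.symm
  intro f hf
  rw [RingHom.mem_ker] at hf
  have := DFunLike.congr_fun key f
  simp only [AlgHom.comp_apply] at this
  erw [hf] at this
  exact Ideal.Quotient.eq_zero_iff_mem.mp (by simpa using this.symm)

theorem isSMulRegular_quotient_of_isPrime {R : Type*} [CommRing R] {J : Ideal R} [J.IsPrime] {u : R}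
    (hu : u ∉ J) : IsSMulRegular (R ⧸ J) u := by
  rw [isSMulRegular_iff_right_eq_zero_of_smul]
  intro x hx
  obtain ⟨x, rfl⟩ := Ideal.Quotient.mk_surjective x
  rw [Algebra.smul_def, Ideal.Quotient.algebraMap_eq, ← map_mul, Ideal.Quotient.eq_zero_iff_mem] at hx
  exact Ideal.Quotient.eq_zero_iff_mem.mpr ((Ideal.IsPrime.mem_or_mem ‹_› hx).resolve_left hu)

/-- The first `i` elements generate the kernel of a substitution of constants for variables, which
is prime and does not contain the next element. -/
theorem isWeaklyRegular_X_sub_C {k : Type*} [Field k] {d : ℕ} (c : Fin d → k) :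
    RingTheory.Sequence.IsWeaklyRegular (MvPolynomial (Fin d) k)
      (List.ofFn fun i => (X i - C (c i) : MvPolynomial (Fin d) k)) := by
  rw [RingTheory.Sequence.isWeaklyRegular_iff]
  intro i hi
  set L := List.ofFn fun i => (X i - C (c i) : MvPolynomial (Fin d) k)
  have hid : i < d := by simpa [L] using hi
  let θ : MvPolynomial (Fin d) k →ₐ[k] MvPolynomial (Fin d) k :=
    aeval fun j => if (j : ℕ) < i then C (c j) else X j
  have hker : Ideal.ofList (L.take i) = RingHom.ker θ := by
    apply le_antisymm
    · rw [Ideal.ofList, Ideal.span_le]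
      rintro u hu
      obtain ⟨j, hj, rfl⟩ := List.mem_iff_getElem.mp hu
      have hj' : j < i := by
        rw [List.length_take] at hj
        omega
      simp [L, θ, RingHom.mem_ker, hj']
    · refine ker_le_of_sub_mem θ (AlgHom.id k _) _ fun j => ?_
      by_cases hj : (j : ℕ) < i
      · refine Ideal.subset_span ?_
        refine List.mem_iff_getElem.mpr ⟨j, ?_, ?_⟩
        · simp [L, hj]
        · simp [L, θ, hj]
      · simp [θ, hj]
  have : (Ideal.ofList (L.take i)).IsPrime := by
    rw [hker]
    exact RingHom.ker_isPrime _
  have heq : (Ideal.ofList (L.take i) • ⊤ : Submodule (MvPolynomial (Fin d) k) _)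
      = Ideal.ofList (L.take i) := by simp
  rw [heq]
  apply isSMulRegular_quotient_of_isPrime
  rw [hker, RingHom.mem_ker]
  simp only [List.getElem_ofFn, θ, map_sub, aeval_X, lt_irrefl, if_false, algHom_C]
  intro h0
  have := congrArg (coeff (Finsupp.single (⟨i, hid⟩ : Fin d) 1)) h0
  simp [coeff_C, coeff_X, algebraMap_eq, Finsupp.single_eq_zero, eq_comm (a := (0 : Fin d →₀ ℕ))] at this

end RegularSequence

end GradedChow

noncomputable section

namespace GradedChow

/-! ### Ideals of lines and planes through the origin. -/

section Lines

variable {k : Type*} [Field k] {d : ℕ}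

/-- Restriction of polynomial functions to the line spanned by `v`. -/
def lineHom (v : Fin d → k) : MvPolynomial (Fin d) k →ₐ[k] Polynomial k :=
  aeval fun i => Polynomial.C (v i) * Polynomial.X

/-- The homogeneous ideal of the line spanned by `v`. -/
def lineIdeal (v : Fin d → k) : Ideal (MvPolynomial (Fin d) k) := RingHom.ker (lineHom v)

/-- Restriction of polynomial functions to the span of `v` and the `j`-th basis vector. -/
def planeHom (v : Fin d → k) (j : Fin d) : MvPolynomial (Fin d) k →ₐ[k] MvPolynomial (Fin 2) k :=
  aeval fun i => if i = j then X 1 else C (v i) * X 0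

/-- The homogeneous ideal of the span of `v` and the `j`-th basis vector. -/
def planeIdeal (v : Fin d → k) (j : Fin d) : Ideal (MvPolynomial (Fin d) k) :=
  RingHom.ker (planeHom v j)

/-- The linear form `X_j - (v_j / v_i) X_i`, which vanishes at `v`. -/
def lineForm (v : Fin d → k) (i j : Fin d) : MvPolynomial (Fin d) k :=
  X j - C (v j / v i) * X i

instance (v : Fin d → k) : (lineIdeal v).IsPrime := RingHom.ker_isPrime _

instance (v : Fin d → k) (j : Fin d) : (planeIdeal v j).IsPrime := RingHom.ker_isPrime _

theorem mem_lineIdeal {v : Fin d → k} {f : MvPolynomial (Fin d) k} :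
    f ∈ lineIdeal v ↔ lineHom v f = 0 := RingHom.mem_ker

theorem mem_planeIdeal {v : Fin d → k} {j : Fin d} {f : MvPolynomial (Fin d) k} :
    f ∈ planeIdeal v j ↔ planeHom v j f = 0 := RingHom.mem_ker

@[simp]
theorem lineHom_X (v : Fin d → k) (i : Fin d) :
    lineHom v (X i) = Polynomial.C (v i) * Polynomial.X := by
  simp [lineHom]

@[simp]
theorem lineHom_C (v : Fin d → k) (c : k) : lineHom v (C c) = Polynomial.C c := by
  simp [lineHom]

theorem lineHom_of_isHomogeneous (v : Fin d → k) {f : MvPolynomial (Fin d) k} {i : ℕ}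
    (hf : f.IsHomogeneous i) : lineHom v f = Polynomial.C (eval v f) * Polynomial.X ^ i := by
  rw [lineHom, aeval_def, eval₂_eq', eval_eq', map_sum, Finset.sum_mul]
  refine Finset.sum_congr rfl fun e he => ?_
  have hdeg : ∑ j, e j = i := by
    rw [← hf (mem_support_iff.mp he), Finsupp.weight_apply, Finsupp.sum_fintype] <;> simp
  rw [← hdeg]
  simp only [mul_pow, Finset.prod_mul_distrib, Finset.prod_pow_eq_pow_sum, map_mul, map_prod,
    map_pow, Polynomial.algebraMap_eq]
  ring

theorem lineForm_mem_lineIdeal {v : Fin d → k} {i : Fin d} (hi : v i ≠ 0) (j : Fin d) :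
    lineForm v i j ∈ lineIdeal v := by
  rw [mem_lineIdeal, lineForm, map_sub, map_mul, lineHom_X, lineHom_X, lineHom_C, ← mul_assoc,
    ← map_mul, div_mul_cancel₀ _ hi, sub_self]

/-- Together with `lineForm_mem_lineIdeal` this shows that the linear forms generate the ideal of
the line; `t ↦ X_i / v_i` is the section of the restriction map. -/
theorem lineIdeal_le {v : Fin d → k} {i : Fin d} {J : Ideal (MvPolynomial (Fin d) k)}
    (h : ∀ j, lineForm v i j ∈ J) : lineIdeal v ≤ J := by
  refine ker_le_of_sub_mem _ (Polynomial.aeval (C (v i)⁻¹ * X i)) _ fun j => ?_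
  convert h j using 1
  simp [lineForm, div_eq_mul_inv, mul_assoc, algebraMap_eq]

theorem lineForm_mem_planeIdeal {v : Fin d → k} {i j l : Fin d} (hi : v i ≠ 0) (hij : i ≠ j)
    (hl : l ≠ j) : lineForm v i l ∈ planeIdeal v j := by
  rw [mem_planeIdeal, lineForm, planeHom]
  simp only [map_sub, aeval_X, map_mul, algHom_C, algebraMap_eq, if_neg hij, if_neg hl]
  rw [← mul_assoc, ← map_mul, div_mul_cancel₀ _ hi, sub_self]

theorem lineForm_notMem_planeIdeal {v : Fin d → k} {i j : Fin d} (hi : v i ≠ 0) (hij : i ≠ j) :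
    lineForm v i j ∉ planeIdeal v j := by
  rw [mem_planeIdeal, lineForm, planeHom]
  simp only [map_sub, aeval_X, map_mul, algHom_C, algebraMap_eq, if_neg hij, if_true]
  rw [← mul_assoc, ← map_mul, div_mul_cancel₀ _ hi]
  intro h
  have := congrArg (eval ![0, 1]) h
  simp at this

theorem planeIdeal_le {v : Fin d → k} {i j : Fin d}
    {J : Ideal (MvPolynomial (Fin d) k)}
    (h : ∀ l, l ≠ j → lineForm v i l ∈ J) : planeIdeal v j ≤ J := by
  refine ker_le_of_sub_mem _ (aeval ![C (v i)⁻¹ * X i, X j]) _ fun l => ?_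
  by_cases hl : l = j
  · subst hl
    simp [planeHom]
  · convert h l hl using 1
    simp [planeHom, hl, lineForm, div_eq_mul_inv, mul_assoc, algebraMap_eq]

theorem planeIdeal_le_lineIdeal {v : Fin d → k} {i j : Fin d} (hi : v i ≠ 0) :
    planeIdeal v j ≤ lineIdeal v :=
  planeIdeal_le fun l _ => lineForm_mem_lineIdeal hi l

theorem ringKrullDim_quotient_lineIdeal {v : Fin d → k} {i : Fin d} (hi : v i ≠ 0) :
    ringKrullDim (MvPolynomial (Fin d) k ⧸ lineIdeal v) = (((1 : ℕ) : ℕ∞) : WithBot ℕ∞) := by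
  have : Function.Surjective (lineHom v) := by
    intro p
    refine ⟨Polynomial.aeval (C (v i)⁻¹ * X i) p, ?_⟩
    rw [← AlgHom.comp_apply]
    convert AlgHom.id_apply (R := k) p
    ext1
    simp only [AlgHom.comp_apply, Polynomial.aeval_X, AlgHom.id_apply]
    rw [map_mul, lineHom_X, lineHom_C, ← mul_assoc, ← map_mul, inv_mul_cancel₀ hi, map_one, one_mul]
  refine (ringKrullDim_quotient_ker (lineHom v : MvPolynomial (Fin d) k →+* Polynomial k)
    this).trans ?_
  rw [Polynomial.ringKrullDim_of_isNoetherianRing, ringKrullDim_eq_zero_of_field]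
  rfl

theorem ringKrullDim_quotient_planeIdeal {v : Fin d → k} {i j : Fin d} (hi : v i ≠ 0)
    (hij : i ≠ j) :
    ringKrullDim (MvPolynomial (Fin d) k ⧸ planeIdeal v j) = (((2 : ℕ) : ℕ∞) : WithBot ℕ∞) := by
  have : Function.Surjective (planeHom v j) := by
    intro p
    refine ⟨aeval ![C (v i)⁻¹ * X i, X j] p, ?_⟩
    rw [← AlgHom.comp_apply]
    convert AlgHom.id_apply (R := k) p
    ext1 l
    fin_cases l
    · simp only [AlgHom.comp_apply, aeval_X, AlgHom.id_apply, planeHom, Fin.zero_eta,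
        Matrix.cons_val_zero, map_mul, algHom_C, algebraMap_eq, if_neg hij]
      rw [← mul_assoc, ← map_mul, inv_mul_cancel₀ hi, map_one, one_mul]
    · simp [planeHom]
  refine (ringKrullDim_quotient_ker (planeHom v j : MvPolynomial (Fin d) k →+*
    MvPolynomial (Fin 2) k) this).trans ?_
  rw [MvPolynomial.ringKrullDim_of_isNoetherianRing, ringKrullDim_eq_zero_of_field]
  simp

/-- A homogeneous prime of dimension one in a polynomial ring over an algebraically closed field is
the ideal of a line. -/
theorem exists_eq_lineIdeal [IsAlgClosed k] {p : Ideal (MvPolynomial (Fin d) k)} [p.IsPrime]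
    (hhom : ∀ f ∈ p, ∀ i, homogeneousComponent i f ∈ p)
    (hdim : ringKrullDim (MvPolynomial (Fin d) k ⧸ p) = (((1 : ℕ) : ℕ∞) : WithBot ℕ∞)) :
    ∃ (v : Fin d → k) (i : Fin d), v i ≠ 0 ∧ p = lineIdeal v := by
  -- Nullstellensatz for the prime ideal `p`.
  have hnull : vanishingIdeal k (zeroLocus k p) = p := by
    simp
  by_cases hv : ∃ v ∈ zeroLocus k p, v ≠ 0
  -- By homogeneity, a nonzero zero of `p` brings its whole line along, so `p` lies in the line
  -- ideal; equal dimensions then give equality.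
  · obtain ⟨v, hv, hv0⟩ := hv
    obtain ⟨i, hi⟩ := Function.ne_iff.mp hv0
    refine ⟨v, i, hi, eq_of_le_of_ringKrullDim_quotient ?_ hdim
      (ringKrullDim_quotient_lineIdeal hi)⟩
    intro f hf
    rw [mem_lineIdeal, ← sum_homogeneousComponent f, map_sum]
    refine Finset.sum_eq_zero fun j _ => ?_
    rw [lineHom_of_isHomogeneous v (homogeneousComponent_isHomogeneous j f)]
    have := hv _ (hhom f hf j)
    rw [aeval_eq_eval] at this
    change eval v _ = 0 at this
    rw [this, map_zero, zero_mul]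
  -- If the origin is the only possible zero, `p` is its maximal ideal, of dimension `0`.
  · exfalso
    push Not at hv
    have hle : vanishingIdeal k {(0 : Fin d → k)} ≤ p := by
      rw [← hnull]
      exact vanishingIdeal_anti_mono fun v h => hv v h
    have hmax : (vanishingIdeal k {(0 : Fin d → k)}).IsMaximal := inferInstance
    have : p.IsMaximal := by
      rwa [← hmax.eq_of_le (Ideal.IsPrime.ne_top ‹_›) hle]
    let := Ideal.Quotient.field p
    rw [ringKrullDim_eq_zero_of_field] at hdim
    have h1 : ((0 : ℕ) : WithBot ℕ∞) = ((1 : ℕ) : WithBot ℕ∞) := by exact_mod_cast hdim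
    exact absurd (Nat.cast_injective h1) (by norm_num)

end Lines

end GradedChow

end

noncomputable section

namespace GradedChow

/-! ### Elements of minimal spread in an ideal. -/

section MinimalSpread

variable {k R : Type*} [Field k] [CommRing R] [Algebra k R] (ℛ : ℕ → Submodule k R)
  [GradedAlgebra ℛ]

/-- The degrees of the non-zero homogeneous components of `g` lie in an interval of length `N`. -/
def HasSpread (N : ℕ) (g : R) : Prop :=
  ∃ l : ℕ, ∀ i, (DirectSum.decompose ℛ g i : R) ≠ 0 → l ≤ i ∧ i < l + N

theorem exists_hasSpread (g : R) : ∃ N, HasSpread ℛ N g := by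
  classical
  refine ⟨(DirectSum.decompose ℛ g).support.sup id + 1, 0, fun i hi => ⟨Nat.zero_le _, ?_⟩⟩
  have : i ∈ (DirectSum.decompose ℛ g).support := by
    rw [DFinsupp.mem_support_iff]
    intro h
    exact hi (by rw [h]; rfl)
  have h2 : id i ≤ (DirectSum.decompose ℛ g).support.sup id := Finset.le_sup this
  simp only [id] at h2
  omega

theorem HasSpread.eq_zero {g : R} (h : HasSpread ℛ 0 g) : g = 0 := by
  obtain ⟨l, hl⟩ := h
  apply (DirectSum.decompose ℛ).injective
  rw [DirectSum.decompose_zero]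
  ext i
  by_contra hi
  have := hl i hi
  omega

theorem HasSpread.of_top_eq_zero {g : R} {M l : ℕ}
    (h : ∀ i, (DirectSum.decompose ℛ g i : R) ≠ 0 → l ≤ i ∧ i < l + (M + 1))
    (h0 : (DirectSum.decompose ℛ g (l + M) : R) = 0) : HasSpread ℛ M g := by
  refine ⟨l, fun i hi => ?_⟩
  have h1 := h i hi
  have : i ≠ l + M := by
    rintro rfl
    exact hi h0
  omega

/-- For a non-zero element `f` of `P` of minimal spread, every element of `P` becomes a multiple
of `f` after multiplication with a non-zero homogeneous element. -/
theorem exists_homogeneous_mul_mem_span_of_minimal [IsDomain R] {P : Ideal R} {f : R} {N : ℕ}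
    (hfP : f ∈ P) (hf0 : f ≠ 0) (hf : HasSpread ℛ N f)
    (hmin : ∀ g ∈ P, g ≠ 0 → ∀ M, HasSpread ℛ M g → N ≤ M) :
    ∀ M, ∀ g ∈ P, HasSpread ℛ M g →
      ∃ h : R, SetLike.IsHomogeneousElem ℛ h ∧ h ≠ 0 ∧ h * g ∈ Ideal.span {f} := by
  intro M
  induction M with
  | zero =>
    intro g _ hg
    exact ⟨1, ⟨0, SetLike.GradedOne.one_mem⟩, one_ne_zero, by simp [hg.eq_zero]⟩
  | succ M ih =>
    intro g hgP hg
    obtain ⟨l, hl⟩ := hg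
    by_cases hb : (DirectSum.decompose ℛ g (l + M) : R) = 0
    · exact ih g hgP (HasSpread.of_top_eq_zero ℛ hl hb)
    have hg0 : g ≠ 0 := by
      rintro rfl
      simp at hb
    have hNM : N ≤ M + 1 := hmin g hgP hg0 _ ⟨l, hl⟩
    obtain ⟨K, rfl⟩ : ∃ K, N = K + 1 := by
      refine Nat.exists_eq_succ_of_ne_zero ?_
      rintro rfl
      exact hf0 hf.eq_zero
    obtain ⟨e, he⟩ := hf
    have ha : (DirectSum.decompose ℛ f (e + K) : R) ≠ 0 := fun h => by
      have := hmin f hfP hf0 K (HasSpread.of_top_eq_zero ℛ he h)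
      omega
    set a : R := ((DirectSum.decompose ℛ f (e + K) : ℛ (e + K)) : R) with ha_def
    set b : R := ((DirectSum.decompose ℛ g (l + M) : ℛ (l + M)) : R) with hb_def
    have haℛ : a ∈ ℛ (e + K) := SetLike.coe_mem _
    have hbℛ : b ∈ ℛ (l + M) := SetLike.coe_mem _
    -- Cross-multiplying by the top components cancels the top degree `l + M + e + K`. Minimality of
    -- `f` gives `K ≤ M`, so `b * f` starts no lower than `a * g` may, in degree `l + e + K`.
    have hspread : HasSpread ℛ M (a * g - b * f) := by
      refine ⟨l + (e + K), fun i hi => ?_⟩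
      rw [DirectSum.decompose_sub, DirectSum.sub_apply, AddSubgroupClass.coe_sub,
        DirectSum.coe_decompose_mul_of_left_mem ℛ i haℛ,
        DirectSum.coe_decompose_mul_of_left_mem ℛ i hbℛ] at hi
      have htop : i ≠ (l + M) + (e + K) := by
        rintro rfl
        rw [if_pos (by omega), if_pos (by omega), Nat.add_sub_cancel, Nat.add_sub_cancel_left,
          ← ha_def, ← hb_def, mul_comm, sub_self] at hi
        exact hi rfl
      by_cases h1 : e + K ≤ i ∧ (DirectSum.decompose ℛ g (i - (e + K)) : R) ≠ 0
      · have := hl _ h1.2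
        omega
      · have h2 : l + M ≤ i ∧ (DirectSum.decompose ℛ f (i - (l + M)) : R) ≠ 0 := by
          by_contra h2
          apply hi
          have e1 : (if e + K ≤ i then a * (DirectSum.decompose ℛ g (i - (e + K)) : R) else 0)
              = 0 := by
            split_ifs with h
            · rw [not_and, not_not] at h1
              rw [h1 h, mul_zero]
            · rfl
          have e2 : (if l + M ≤ i then b * (DirectSum.decompose ℛ f (i - (l + M)) : R) else 0)
              = 0 := by
            split_ifs with h
            · rw [not_and, not_not] at h2
              rw [h2 h, mul_zero]
            · rfl
          rw [e1, e2, sub_zero]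
        have := he _ h2.2
        omega
    obtain ⟨h, ⟨j, hj⟩, hh0, hh⟩ := ih (a * g - b * f)
      (P.sub_mem (P.mul_mem_left _ hgP) (P.mul_mem_left _ hfP)) hspread
    refine ⟨h * a, ⟨j + (e + K), SetLike.GradedMul.mul_mem hj haℛ⟩, mul_ne_zero hh0 ha, ?_⟩
    have : h * a * g = h * (a * g - b * f) + (h * b) * f := by ring
    rw [this]
    exact add_mem hh (Ideal.mul_mem_left _ _ (Ideal.mem_span_singleton_self f))

/-- Take `f` of minimal spread; as `P` is finitely generated, the product of the homogeneous
multipliers of its generators works for all of `P`. -/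
theorem exists_mul_mem_span_singleton [IsDomain R] [IsNoetherianRing R] {P : Ideal R}
    (hP : P ≠ ⊥) : ∃ f ∈ P, f ≠ 0 ∧ ∃ h : R, SetLike.IsHomogeneousElem ℛ h ∧ h ≠ 0 ∧
      ∀ g ∈ P, h * g ∈ Ideal.span {f} := by
  classical
  obtain ⟨f₁, hf₁, hf₁0⟩ := Submodule.exists_mem_ne_zero_of_ne_bot hP
  have hex : ∃ N, ∃ f ∈ P, f ≠ 0 ∧ HasSpread ℛ N f := by
    obtain ⟨N, hN⟩ := exists_hasSpread ℛ f₁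
    exact ⟨N, f₁, hf₁, hf₁0, hN⟩
  obtain ⟨f, hfP, hf0, hf⟩ := Nat.find_spec hex
  have hdiv : ∀ g ∈ P, ∃ h : R, SetLike.IsHomogeneousElem ℛ h ∧ h ≠ 0 ∧
      h * g ∈ Ideal.span {f} := fun g hg => by
    obtain ⟨M, hM⟩ := exists_hasSpread ℛ g
    exact exists_homogeneous_mul_mem_span_of_minimal ℛ hfP hf0 hf
      (fun g hg hg0 M hM => Nat.find_min' hex ⟨g, hg, hg0, hM⟩) M g hg hM
  refine ⟨f, hfP, hf0, ?_⟩
  obtain ⟨S, hS⟩ := IsNoetherian.noetherian P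
  choose! h hhom hne hmem using hdiv
  have hSP : ∀ g ∈ S, g ∈ P := fun g hg => by
    rw [← hS]
    exact Submodule.subset_span hg
  refine ⟨∏ g ∈ S, h g, ?_, Finset.prod_ne_zero_iff.mpr fun g hg => hne g (hSP g hg), ?_⟩
  · exact (SetLike.homogeneousSubmonoid ℛ).prod_mem fun g hg => hhom g (hSP g hg)
  · have hle : P ≤ Submodule.comap (LinearMap.mulLeft R (∏ g ∈ S, h g)) (Ideal.span {f}) := by
      nth_rw 1 [← hS]
      rw [Submodule.span_le]
      intro g hg
      rw [SetLike.mem_coe, Submodule.mem_comap, LinearMap.mulLeft_apply,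
        ← Finset.prod_erase_mul _ _ (Finset.mem_coe.mp hg), mul_assoc]
      exact Ideal.mul_mem_left _ _ (hmem g (hSP g hg))
    exact fun g hg => hle hg

end MinimalSpread

theorem isAddTorsion_quotient_of_single {α : Type*} (H : AddSubgroup (α →₀ ℤ))
    (h : ∀ a, ∃ n : ℕ, n ≠ 0 ∧ Finsupp.single a (n : ℤ) ∈ H) : IsAddTorsion ((α →₀ ℤ) ⧸ H) := by
  have hs : ∀ a (n : ℤ), (QuotientAddGroup.mk (Finsupp.single a n) : (α →₀ ℤ) ⧸ H) ∈
      AddCommGroup.torsion ((α →₀ ℤ) ⧸ H) := by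
    intro a n
    have : (QuotientAddGroup.mk (Finsupp.single a n) : (α →₀ ℤ) ⧸ H) =
        n • QuotientAddGroup.mk (Finsupp.single a 1) := by
      rw [← QuotientAddGroup.mk_zsmul]
      simp
    rw [this]
    refine zsmul_mem ?_ n
    obtain ⟨l, hl0, hl⟩ := h a
    refine isOfFinAddOrder_iff_nsmul_eq_zero.mpr ⟨l, Nat.pos_of_ne_zero hl0, ?_⟩
    rw [← QuotientAddGroup.mk_nsmul, QuotientAddGroup.eq_zero_iff]
    simpa using hl
  intro x
  induction x using QuotientAddGroup.induction_on with
  | H z =>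
    change _ ∈ AddCommGroup.torsion ((α →₀ ℤ) ⧸ H)
    induction z using Finsupp.induction_linear with
    | zero => exact zero_mem _
    | add f g hf hg => exact add_mem hf hg
    | single a b => exact hs a b

end GradedChow

end

noncomputable section

namespace GradedChow

/-! ### Torsion in the Chow groups when lines have unique primes above them. -/

section Torsion

/-- The homogeneous core of `P` is a prime, nonzero because it contains `h`. Were it smaller than
`P`, the chain `0 < core < P` would be too long for dimension `2`. -/
theorem isHomogeneous_of_homogeneous_mem {k R : Type*} [Field k] [CommRing R]
    [Algebra k R] (ℛ : ℕ → Submodule k R) [GradedAlgebra ℛ] [IsDomain R]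
    (hdim : ringKrullDim R = (((2 : ℕ) : ℕ∞) : WithBot ℕ∞)) {P : Ideal R} [P.IsPrime]
    (hP : ringKrullDim (R ⧸ P) = (((1 : ℕ) : ℕ∞) : WithBot ℕ∞)) {h : R} (hh : h ≠ 0)
    (hhom : SetLike.IsHomogeneousElem ℛ h) (hmem : h ∈ P) : P.IsHomogeneous ℛ := by
  set Q : Ideal R := (P.homogeneousCore ℛ).toIdeal with hQ
  have hQprime : Q.IsPrime := Ideal.IsPrime.homogeneousCore ‹_›
  have hQP : Q ≤ P := Ideal.toIdeal_homogeneousCore_le ℛ P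
  have hQbot : ⊥ < Q := by
    rw [bot_lt_iff_ne_bot, Submodule.ne_bot_iff]
    exact ⟨h, Ideal.mem_homogeneousCore_of_homogeneous_of_mem hhom hmem, hh⟩
  rw [Ideal.IsHomogeneous.iff_eq, ← hQ]
  by_contra hne
  have h1 := ringKrullDim_quotient_add_one_le hQbot
  have h2 := ringKrullDim_quotient_add_one_le (lt_of_le_of_ne hQP hne)
  rw [ringKrullDim_eq_of_ringEquiv (RingEquiv.quotientBot R), hdim] at h1
  rw [hP] at h2
  have h3 : (((1 : ℕ) : ℕ∞) : WithBot ℕ∞) + 1 + 1 ≤ (((2 : ℕ) : ℕ∞) : WithBot ℕ∞) :=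
    le_trans (by gcongr) h1
  have h4 : ((3 : ℕ) : WithBot ℕ∞) ≤ ((2 : ℕ) : WithBot ℕ∞) := by exact_mod_cast h3
  have h5 : 3 ≤ 2 := by exact_mod_cast h4
  omega

variable {k : Type*} [Field k] {d m : ℕ} {R : Type*} [CommRing R]
  [Algebra k R] [Algebra (MvPolynomial (Fin d) k) R] (ℛ : ℕ → Submodule k R) [GradedAlgebra ℛ]

theorem algebraMap_homogeneousComponent_mem (hm : 0 < m)
    (hdeg : ∀ (f : MvPolynomial (Fin d) k) (i : ℕ), f.IsHomogeneous i →
      algebraMap (MvPolynomial (Fin d) k) R f ∈ ℛ (m * i))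
    (f : MvPolynomial (Fin d) k) (i : ℕ) :
    (DirectSum.decompose ℛ (algebraMap (MvPolynomial (Fin d) k) R f) (m * i) : R) =
      algebraMap (MvPolynomial (Fin d) k) R (homogeneousComponent i f) := by
  rw [← GradedRing.proj_apply]
  conv_lhs => rw [← sum_homogeneousComponent f]
  rw [map_sum, map_sum, Finset.sum_eq_single i]
  · rw [GradedRing.proj_apply, DirectSum.decompose_of_mem_same]
    exact hdeg _ _ (homogeneousComponent_isHomogeneous i f)
  · intro j _ hj
    rw [GradedRing.proj_apply]
    refine DirectSum.decompose_of_mem_ne ℛ (hdeg _ _ (homogeneousComponent_isHomogeneous j f)) ?_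
    exact fun h => hj (Nat.eq_of_mul_eq_mul_left hm h)
  · intro hi
    rw [Finset.mem_range, not_lt] at hi
    rw [homogeneousComponent_eq_zero i f (by omega), map_zero, map_zero]

theorem homogeneousComponent_mem_comap (hm : 0 < m)
    (hdeg : ∀ (f : MvPolynomial (Fin d) k) (i : ℕ), f.IsHomogeneous i →
      algebraMap (MvPolynomial (Fin d) k) R f ∈ ℛ (m * i))
    {P : Ideal R} (hP : P.IsHomogeneous ℛ) {f : MvPolynomial (Fin d) k}
    (hf : f ∈ P.comap (algebraMap (MvPolynomial (Fin d) k) R)) (i : ℕ) :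
    homogeneousComponent i f ∈ P.comap (algebraMap (MvPolynomial (Fin d) k) R) := by
  rw [Ideal.mem_comap, ← algebraMap_homogeneousComponent_mem ℛ hm hdeg]
  exact hP (m * i) hf

variable [Algebra.IsIntegral (MvPolynomial (Fin d) k) R]

/-- If there is only one prime over the ideal of each line, a homogeneous prime `P` of dimension
one is the only prime of dimension one which contains a suitable homogeneous prime `Q` of
dimension two and a suitable homogeneous `x ∉ Q`. -/
theorem exists_homogeneous_prime_and_element [IsAlgClosed k] (hd : 2 ≤ d) (hm : 0 < m)
    (hinj : Function.Injective (algebraMap (MvPolynomial (Fin d) k) R))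
    (hdeg : ∀ (f : MvPolynomial (Fin d) k) (i : ℕ), f.IsHomogeneous i →
      algebraMap (MvPolynomial (Fin d) k) R f ∈ ℛ (m * i))
    (huniq : ∀ (v : Fin d → k) (i : Fin d), v i ≠ 0 → ∀ P₁ P₂ : Ideal R, P₁.IsPrime → P₂.IsPrime →
      P₁.comap (algebraMap (MvPolynomial (Fin d) k) R) = lineIdeal v →
      P₂.comap (algebraMap (MvPolynomial (Fin d) k) R) = lineIdeal v → P₁ = P₂)
    (P : HomPrimesOfDim ℛ 1) :
    ∃ (Q : HomPrimesOfDim ℛ (1 + 1)) (x : R), SetLike.IsHomogeneousElem ℛ x ∧ x ∉ Q.1.asIdeal ∧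
      P.1.asIdeal ∈ (Q.1.asIdeal ⊔ Ideal.span {x}).minimalPrimes ∧
      ∀ P' : PrimesOfDim R 1, Q.1.asIdeal ⊔ Ideal.span {x} ≤ P'.1.asIdeal → P'.1 = P.1 := by
  obtain ⟨⟨P, hPprime⟩, hPhom, hPdim⟩ := P
  simp only at hPhom hPdim ⊢
  obtain ⟨v, i, hi, hPv⟩ := exists_eq_lineIdeal
    (p := P.comap (algebraMap (MvPolynomial (Fin d) k) R))
    (fun f hf i => homogeneousComponent_mem_comap ℛ hm hdeg hPhom hf i)
    ((ringKrullDim_quotient_comap P).symm.trans hPdim)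
  obtain ⟨j, hij⟩ : ∃ j, i ≠ j := by
    have : Nontrivial (Fin d) := Fin.nontrivial_iff_two_le.mpr hd
    obtain ⟨j, hj⟩ := exists_ne i
    exact ⟨j, hj.symm⟩
  obtain ⟨Q₀, -, hQ₀prime, hQ₀⟩ := Ideal.exists_ideal_over_prime_of_isIntegral (planeIdeal v j)
    (⊥ : Ideal R) (by
      rw [← RingHom.ker_eq_comap_bot, (RingHom.injective_iff_ker_eq_bot _).mp hinj]
      exact bot_le)
  have hform : ∀ l, algebraMap (MvPolynomial (Fin d) k) R (lineForm v i l) ∈ ℛ (m * 1) :=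
    fun l => hdeg _ _ ((isHomogeneous_X k l).sub (isHomogeneous_C_mul_X _ _))
  -- Passing to the homogeneous core keeps the contraction, since the plane ideal is generated by
  -- linear forms, which are homogeneous in `R`.
  set Q : Ideal R := (Q₀.homogeneousCore ℛ).toIdeal
  have hQprime : Q.IsPrime := hQ₀prime.homogeneousCore
  have hQhom : Q.IsHomogeneous ℛ := (Q₀.homogeneousCore ℛ).isHomogeneous
  have hQcomap : Q.comap (algebraMap (MvPolynomial (Fin d) k) R) = planeIdeal v j := by
    apply le_antisymm
    · rw [← hQ₀]
      exact Ideal.comap_mono (Ideal.toIdeal_homogeneousCore_le ℛ Q₀)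
    · refine planeIdeal_le (i := i) fun l hl => ?_
      refine Ideal.mem_homogeneousCore_of_homogeneous_of_mem ⟨_, hform l⟩ ?_
      rw [← Ideal.mem_comap, hQ₀]
      exact lineForm_mem_planeIdeal hi hij hl
  have hQdim : ringKrullDim (R ⧸ Q) = (((1 + 1 : ℕ) : ℕ∞) : WithBot ℕ∞) := by
    rw [ringKrullDim_quotient_comap (R := MvPolynomial (Fin d) k) Q, hQcomap]
    exact ringKrullDim_quotient_planeIdeal hi hij
  set x := algebraMap (MvPolynomial (Fin d) k) R (lineForm v i j) with hx
  have hle : ∀ P' : Ideal R, Q ⊔ Ideal.span {x} ≤ P' →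
      lineIdeal v ≤ P'.comap (algebraMap (MvPolynomial (Fin d) k) R) := fun P' h => by
    refine lineIdeal_le (i := i) fun l => ?_
    rw [sup_le_iff, Ideal.span_singleton_le_iff_mem] at h
    by_cases hl : l = j
    · rw [hl]
      exact h.2
    · apply Ideal.comap_mono h.1
      rw [hQcomap]
      exact lineForm_mem_planeIdeal hi hij hl
  -- Going up produces a prime over the line that contains `Q`; by uniqueness it is `P`.
  have hQP : Q ⊔ Ideal.span {x} ≤ P := by
    obtain ⟨P₁, hP₁, hP₁prime, hP₁v⟩ := Ideal.exists_ideal_over_prime_of_isIntegral (lineIdeal v) Q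
      (by rw [hQcomap]; exact planeIdeal_le_lineIdeal hi)
    have := huniq v i hi P P₁ hPprime hP₁prime hPv hP₁v
    rw [sup_le_iff, Ideal.span_singleton_le_iff_mem]
    refine ⟨this ▸ hP₁, ?_⟩
    rw [hx, ← Ideal.mem_comap, hPv]
    exact lineForm_mem_lineIdeal hi j
  refine ⟨⟨⟨Q, hQprime⟩, hQhom, hQdim⟩, x, ⟨_, hform j⟩, ?_, ⟨⟨hPprime, hQP⟩, ?_⟩, ?_⟩
  · change x ∉ Q
    rw [hx, ← Ideal.mem_comap, hQcomap]
    exact lineForm_notMem_planeIdeal hi hij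
  · rintro P' ⟨hP', hQP'⟩ hP'P
    refine (huniq v i hi P P' hPprime hP' hPv ?_).le
    exact le_antisymm ((Ideal.comap_mono hP'P).trans hPv.le) (hle P' hQP')
  · rintro ⟨⟨P', hP'⟩, hP'dim⟩ hQP'
    simp only at hQP' hP'dim
    ext1
    refine huniq v i hi P' P hP' hPprime (eq_of_le_of_ringKrullDim_quotient (hle P' hQP')
      (ringKrullDim_quotient_lineIdeal hi) ?_).symm hPv
    exact (ringKrullDim_quotient_comap P').symm.trans hP'dim

variable [IsNoetherianRing R]

/-- All terms of `div(Q, x)` except the one at `P` vanish, and the coefficient there is a nonzero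
length. -/
theorem isAddTorsion_gradedChowGroup [IsAlgClosed k] (hd : 2 ≤ d) (hm : 0 < m)
    (hinj : Function.Injective (algebraMap (MvPolynomial (Fin d) k) R))
    (hdeg : ∀ (f : MvPolynomial (Fin d) k) (i : ℕ), f.IsHomogeneous i →
      algebraMap (MvPolynomial (Fin d) k) R f ∈ ℛ (m * i))
    (huniq : ∀ (v : Fin d → k) (i : Fin d), v i ≠ 0 → ∀ P₁ P₂ : Ideal R, P₁.IsPrime → P₂.IsPrime →
      P₁.comap (algebraMap (MvPolynomial (Fin d) k) R) = lineIdeal v →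
      P₂.comap (algebraMap (MvPolynomial (Fin d) k) R) = lineIdeal v → P₁ = P₂) :
    IsAddTorsion (GradedChowGroup ℛ 1) := by
  refine isAddTorsion_quotient_of_single _ fun P => ?_
  obtain ⟨Q, x, hx, hxQ, hmin, honly⟩ :=
    exists_homogeneous_prime_and_element ℛ hd hm hinj hdeg huniq P
  refine ⟨_, lengthAt_ne_zero _ P.1 hmin, AddSubgroup.subset_closure ⟨Q, x, hx, hxQ, ?_⟩⟩
  rw [gradedCycleOf, finsum_eq_single _ P]
  intro P' hP'
  rw [lengthAt_eq_zero, Nat.cast_zero, Finsupp.single_zero]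
  exact fun h => hP' (Subtype.ext (honly ⟨P'.1, P'.2.2⟩ h))

/-- The same divisor, now read among all one-dimensional primes and not only the homogeneous ones.
-/
theorem exists_single_mem_ratEquiv [IsAlgClosed k] (hd : 2 ≤ d) (hm : 0 < m)
    (hinj : Function.Injective (algebraMap (MvPolynomial (Fin d) k) R))
    (hdeg : ∀ (f : MvPolynomial (Fin d) k) (i : ℕ), f.IsHomogeneous i →
      algebraMap (MvPolynomial (Fin d) k) R f ∈ ℛ (m * i))
    (huniq : ∀ (v : Fin d → k) (i : Fin d), v i ≠ 0 → ∀ P₁ P₂ : Ideal R, P₁.IsPrime → P₂.IsPrime →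
      P₁.comap (algebraMap (MvPolynomial (Fin d) k) R) = lineIdeal v →
      P₂.comap (algebraMap (MvPolynomial (Fin d) k) R) = lineIdeal v → P₁ = P₂)
    (P : PrimesOfDim R 1) (hP : P.1.asIdeal.IsHomogeneous ℛ) :
    ∃ n : ℕ, n ≠ 0 ∧ Finsupp.single P (n : ℤ) ∈ ratEquiv R 1 := by
  obtain ⟨Q, x, hx, hxQ, hmin, honly⟩ :=
    exists_homogeneous_prime_and_element ℛ hd hm hinj hdeg huniq ⟨P.1, hP, P.2⟩
  refine ⟨_, lengthAt_ne_zero _ P.1 hmin,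
    AddSubgroup.subset_closure ⟨⟨Q.1, Q.2.2⟩, x, hxQ, ?_⟩⟩
  rw [cycleOf, finsum_eq_single _ P]
  intro P' hP'
  rw [lengthAt_eq_zero, Nat.cast_zero, Finsupp.single_zero]
  exact fun h => hP' (Subtype.ext (honly P' h))

theorem isAddTorsion_chowGroup [IsAlgClosed k] [IsDomain R] (hd : 2 ≤ d) (hm : 0 < m)
    (hdim : ringKrullDim R = (((2 : ℕ) : ℕ∞) : WithBot ℕ∞))
    (hinj : Function.Injective (algebraMap (MvPolynomial (Fin d) k) R))
    (hdeg : ∀ (f : MvPolynomial (Fin d) k) (i : ℕ), f.IsHomogeneous i →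
      algebraMap (MvPolynomial (Fin d) k) R f ∈ ℛ (m * i))
    (huniq : ∀ (v : Fin d → k) (i : Fin d), v i ≠ 0 → ∀ P₁ P₂ : Ideal R, P₁.IsPrime → P₂.IsPrime →
      P₁.comap (algebraMap (MvPolynomial (Fin d) k) R) = lineIdeal v →
      P₂.comap (algebraMap (MvPolynomial (Fin d) k) R) = lineIdeal v → P₁ = P₂) :
    IsAddTorsion (ChowGroup R 1) := by
  classical
  have hhom := exists_single_mem_ratEquiv ℛ hd hm hinj hdeg huniq
  refine isAddTorsion_quotient_of_single _ fun P => ?_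
  by_cases hP : P.1.asIdeal.IsHomogeneous ℛ
  · exact hhom P hP
  have hPbot : P.1.asIdeal ≠ ⊥ := by
    intro h
    exact hP (h ▸ Ideal.IsHomogeneous.bot ℛ)
  obtain ⟨f, hfP, hf0, h, hhhom, hh0, hhmem⟩ := exists_mul_mem_span_singleton ℛ hPbot
  have hbotdim : ringKrullDim (R ⧸ (⊥ : Ideal R)) = (((1 + 1 : ℕ) : ℕ∞) : WithBot ℕ∞) := by
    rw [ringKrullDim_eq_of_ringEquiv (RingEquiv.quotientBot R), hdim]
  -- The summand `⊥` puts the ideal in the shape required by `ratEquiv`, with `Q = ⊥`.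
  let I : Ideal R := ⊥ ⊔ Ideal.span {f}
  have hI : I = Ideal.span {f} := bot_sup_eq _
  -- A nonzero prime strictly inside `P'` would give a chain too long for dimension `2`.
  have hmin : ∀ P' : PrimesOfDim R 1, I ≤ P'.1.asIdeal → P'.1.asIdeal ∈ I.minimalPrimes := by
    intro P' hP'
    refine ⟨⟨P'.1.2, hP'⟩, ?_⟩
    rintro q ⟨hq, hIq⟩ hqP'
    by_contra hne
    have hqlt : q < P'.1.asIdeal := lt_of_le_of_ne hqP' fun h => hne h.ge
    have hqbot : ⊥ < q := by
      rw [bot_lt_iff_ne_bot, Submodule.ne_bot_iff]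
      exact ⟨f, hIq (hI ▸ Ideal.mem_span_singleton_self f), hf0⟩
    have h1 := ringKrullDim_quotient_add_one_le hqbot
    have h2 := ringKrullDim_quotient_add_one_le hqlt
    rw [hbotdim] at h1
    rw [P'.2] at h2
    have h3 : (((1 : ℕ) : ℕ∞) : WithBot ℕ∞) + 1 + 1 ≤ (((1 + 1 : ℕ) : ℕ∞) : WithBot ℕ∞) :=
      le_trans (by gcongr) h1
    have h4 : ((3 : ℕ) : WithBot ℕ∞) ≤ ((2 : ℕ) : WithBot ℕ∞) := by exact_mod_cast h3
    have h5 : 3 ≤ 2 := by exact_mod_cast h4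
    omega
  have hIP : I ≤ P.1.asIdeal := by
    rw [hI, Ideal.span_singleton_le_iff_mem]
    exact hfP
  have hz : cycleOf 1 (R ⧸ I) ∈ ratEquiv R 1 :=
    AddSubgroup.subset_closure ⟨⟨⟨⊥, Ideal.isPrime_bot⟩, hbotdim⟩, f, hf0, rfl⟩
  have hfin : {P' : PrimesOfDim R 1 | I ≤ P'.1.asIdeal}.Finite := by
    refine Set.Finite.of_finite_image (f := fun P' : PrimesOfDim R 1 => P'.1.asIdeal)
      ((Ideal.finite_minimalPrimes_of_isNoetherianRing R I).subset ?_) ?_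
    · rintro _ ⟨P', hP', rfl⟩
      exact hmin P' hP'
    · intro P₁ _ P₂ _ h12
      exact Subtype.ext (PrimeSpectrum.ext h12)
  have hsum : cycleOf 1 (R ⧸ I) = ∑ P' ∈ hfin.toFinset,
      Finsupp.single P' (lengthAt (R ⧸ I) P'.1 : ℤ) := by
    refine finsum_eq_sum_of_support_subset _ fun P' hP' => ?_
    rw [Set.Finite.coe_toFinset]
    by_contra hne
    apply hP'
    simp only
    rw [lengthAt_eq_zero I P'.1 hne, Nat.cast_zero, Finsupp.single_zero]
  -- Some `g ∈ P` avoids `P'`, while `h * g ∈ (f) ⊆ P'`; hence `h ∈ P'`, which forces homogeneity.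
  have hothers : ∀ P' ∈ hfin.toFinset.erase P, P'.1.asIdeal.IsHomogeneous ℛ := by
    intro P' hP'
    obtain ⟨hne, hP'⟩ := Finset.mem_erase.mp hP'
    rw [Set.Finite.mem_toFinset] at hP'
    have hPP' : ¬ P.1.asIdeal ≤ P'.1.asIdeal := fun hle =>
      hne (Subtype.ext (PrimeSpectrum.ext (eq_of_le_of_ringKrullDim_quotient hle P.2 P'.2).symm))
    obtain ⟨g, hg, hgP'⟩ := SetLike.not_le_iff_exists.mp hPP'
    refine isHomogeneous_of_homogeneous_mem ℛ hdim P'.2 hh0 hhhom ?_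
    exact (P'.1.2.mem_or_mem (hP' (hI ▸ hhmem g hg))).resolve_right hgP'
  -- The cycles with torsion class. It contains `div(0, f)` and all its homogeneous terms, hence
  -- also the remaining term at `P`.
  let T : AddSubgroup (Cycles R 1) :=
    (AddCommGroup.torsion (ChowGroup R 1)).comap (QuotientAddGroup.mk' (ratEquiv R 1))
  have hT : ∀ z, z ∈ T ↔ ∃ n : ℕ, 0 < n ∧ n • z ∈ ratEquiv R 1 := by
    intro z
    rw [AddSubgroup.mem_comap]
    change IsOfFinAddOrder _ ↔ _
    rw [isOfFinAddOrder_iff_nsmul_eq_zero]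
    refine exists_congr fun n => and_congr_right fun _ => ?_
    rw [← map_nsmul]
    exact QuotientAddGroup.eq_zero_iff _
  have hPT : Finsupp.single P (lengthAt (R ⧸ I) P.1 : ℤ) ∈ T := by
    have hmem : P ∈ hfin.toFinset := by
      rw [Set.Finite.mem_toFinset]
      exact hIP
    rw [← Finset.add_sum_erase _ _ hmem] at hsum
    rw [← sub_eq_iff_eq_add] at hsum
    rw [← hsum]
    refine sub_mem ((hT _).mpr ⟨1, one_pos, by rwa [one_nsmul]⟩) (sum_mem fun P' hP' => ?_)
    obtain ⟨n, hn0, hn⟩ := hhom P' (hothers P' hP')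
    refine (hT _).mpr ⟨n, Nat.pos_of_ne_zero hn0, ?_⟩
    have : n • Finsupp.single P' (lengthAt (R ⧸ I) P'.1 : ℤ) =
        lengthAt (R ⧸ I) P'.1 • Finsupp.single P' (n : ℤ) := by
      rw [Finsupp.smul_single, Finsupp.smul_single, nsmul_eq_mul, nsmul_eq_mul, mul_comm]
    rw [this]
    exact nsmul_mem hn _
  obtain ⟨n, hn0, hn⟩ := (hT _).mp hPT
  refine ⟨n * lengthAt (R ⧸ I) P.1, mul_ne_zero hn0.ne' (lengthAt_ne_zero I P.1 (hmin P hIP)), ?_⟩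
  rwa [Finsupp.smul_single, nsmul_eq_mul, ← Nat.cast_mul] at hn

end Torsion

end GradedChow

end

noncomputable section

namespace GradedChow

/-! ### Cohen–Macaulayness of finite free algebras over a polynomial ring. -/

section CohenMacaulay

/-- Dividing by a regular sequence lowers the dimension by its length, and the quotient, being
nonzero, has dimension at least `0`. -/
theorem grade_maximalIdeal_le_ringKrullDim (S : Type*) [CommRing S] [IsLocalRing S]
    [IsNoetherianRing S] :
    (grade (IsLocalRing.maximalIdeal S) S : WithBot ℕ∞) ≤ ringKrullDim S := by
  rw [← IsLocalRing.maximalIdeal_height_eq_ringKrullDim, WithBot.coe_le_coe]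
  refine iSup_le fun rs => ?_
  rw [← WithBot.coe_le_coe, IsLocalRing.maximalIdeal_height_eq_ringKrullDim,
    ← ringKrullDim_add_length_eq_ringKrullDim_of_isRegular rs.1 rs.2.2]
  have : Nontrivial (S ⧸ Ideal.ofList rs.1) := by
    rw [Ideal.Quotient.nontrivial_iff]
    intro h
    exact rs.2.2.top_ne_smul (by simp [h])
  calc ((rs.1.length : ℕ∞) : WithBot ℕ∞) = 0 + ((rs.1.length : ℕ∞) : WithBot ℕ∞) := (zero_add _).symm
    _ ≤ _ := add_le_add ringKrullDim_nonneg_of_nontrivial le_rfl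

variable {k : Type*} [Field k] {d : ℕ} {A : Type*} [CommRing A]
  [Algebra (MvPolynomial (Fin d) k) A] [Module.Finite (MvPolynomial (Fin d) k) A]

theorem isNoetherianRing_of_finite_mvPolynomial (k : Type*) [Field k] (d : ℕ) (A : Type*)
    [CommRing A] [Algebra (MvPolynomial (Fin d) k) A] [Module.Finite (MvPolynomial (Fin d) k) A] :
    IsNoetherianRing A :=
  isNoetherian_of_tower (MvPolynomial (Fin d) k)
    (inferInstance : IsNoetherian (MvPolynomial (Fin d) k) A)

theorem ringKrullDim_of_finite_mvPolynomial
    (hinj : Function.Injective (algebraMap (MvPolynomial (Fin d) k) A)) :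
    ringKrullDim A = ((d : ℕ∞) : WithBot ℕ∞) := by
  rw [ringKrullDim_eq_of_isIntegral hinj, MvPolynomial.ringKrullDim_of_isNoetherianRing,
    ringKrullDim_eq_zero_of_field]
  simp

/-- A regular sequence on the base ring `B` stays regular on `A_P`, for flat algebras `A`. -/
theorem isRegular_localization_of_flat {B A : Type*} [CommRing B] [CommRing A] [Algebra B A]
    [Module.Flat B A] {us : List B} (hus : RingTheory.Sequence.IsWeaklyRegular B us) (P : Ideal A)
    [P.IsPrime] (hP : ∀ u ∈ us, algebraMap B A u ∈ P) :
    RingTheory.Sequence.IsRegular (Localization.AtPrime P)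
      ((us.map (algebraMap B A)).map (algebraMap A (Localization.AtPrime P))) := by
  refine RingTheory.Sequence.IsWeaklyRegular.isRegular_of_isLocalization_of_mem _ P
    (RingTheory.Sequence.IsWeaklyRegular.of_flat hus) fun r hr => ?_
  obtain ⟨u, hu, rfl⟩ := List.mem_map.mp hr
  exact hP u hu

/-- A maximal ideal `P` lies over a point `c`. The regular sequence `X_i - c_i` stays regular on
`A_P` by flatness, and its length `d` is at least `dim A_P`. -/
theorem isCohenMacaulay_of_free_mvPolynomial [IsAlgClosed k] [Nontrivial A]
    [Module.Free (MvPolynomial (Fin d) k) A] : IsCohenMacaulay A := by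
  have hinj : Function.Injective (algebraMap (MvPolynomial (Fin d) k) A) :=
    FaithfulSMul.algebraMap_injective _ _
  have hnoeth := isNoetherianRing_of_finite_mvPolynomial k d A
  refine ⟨hnoeth, fun P hP => ?_⟩
  have hnoeth' : IsNoetherianRing (Localization.AtPrime P) :=
    IsLocalization.isNoetherianRing P.primeCompl _ hnoeth
  refine ⟨hnoeth', le_antisymm (grade_maximalIdeal_le_ringKrullDim _) ?_⟩
  have hmax : (P.comap (algebraMap (MvPolynomial (Fin d) k) A)).IsMaximal :=
    Ideal.isMaximal_comap_of_isIntegral_of_isMaximal P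
  obtain ⟨c, hc⟩ := isMaximal_iff_eq_vanishingIdeal_singleton.mp hmax
  have hreg := isRegular_localization_of_flat (isWeaklyRegular_X_sub_C c) P (by
    intro u hu
    obtain ⟨i, rfl⟩ := (List.mem_ofFn' _ _).mp hu
    rw [← Ideal.mem_comap, hc, mem_vanishingIdeal_singleton_iff]
    simp)
  have hdim : ringKrullDim (Localization.AtPrime P) ≤ ((d : ℕ∞) : WithBot ℕ∞) := by
    rw [IsLocalization.AtPrime.ringKrullDim_eq_height P,
      ← ringKrullDim_of_finite_mvPolynomial hinj]
    exact Ideal.height_le_ringKrullDim_of_isPrime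
  refine hdim.trans (WithBot.coe_le_coe.mpr ?_)
  refine le_trans ?_ (le_iSup _ ⟨_, ?_, hreg⟩)
  · simp
  · intro r hr
    rw [IsLocalRing.mem_maximalIdeal, mem_nonunits_iff]
    intro hu
    refine hreg.top_ne_smul ?_
    have : Ideal.ofList ((List.map (algebraMap (MvPolynomial (Fin d) k) A)
        (List.ofFn fun i => X i - C (c i))).map (algebraMap A (Localization.AtPrime P))) = ⊤ :=
      Ideal.eq_top_of_isUnit_mem _ (Ideal.subset_span hr) hu
    rw [this]
    simp

end CohenMacaulay

/-! ### Regular sequences of linear forms. -/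

section LinearForms

/-- An element in the span of its predecessors acts as zero on the quotient by them; regularity
would then make that quotient, and so the final one, zero. -/
theorem linearIndependent_of_isRegular {k T : Type*} [Field k] [CommRing T] [Algebra k T]
    {us : List T} (hus : RingTheory.Sequence.IsRegular T us) : LinearIndependent k us.get := by
  have key : ∀ (r : ℕ) (hr : r ≤ us.length),
      LinearIndependent k fun i : Fin r => us[(i : ℕ)]'(by omega) := by
    intro r
    induction r with
    | zero => exact fun _ => linearIndependent_empty_type
    | succ r ih =>
      intro hr
      rw [linearIndependent_finSucc']
      refine ⟨ih (by omega), fun hmem => ?_⟩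
      have hle : Submodule.span k (Set.range (Fin.init fun i : Fin (r + 1) =>
          us[(i : ℕ)]'(by omega))) ≤ (Ideal.ofList (us.take r)).restrictScalars k := by
        rw [Submodule.span_le]
        rintro _ ⟨i, rfl⟩
        refine Ideal.subset_span ?_
        refine List.mem_iff_getElem.mpr ⟨i, ?_, ?_⟩
        · rw [List.length_take]
          omega
        · simp [Fin.init]
      have hmem' : us[r]'(by omega) ∈ Ideal.ofList (us.take r) := hle hmem
      have hreg := hus.regular_mod_prev r (by omega)
      have hone : (1 : T) ∈ Ideal.ofList (us.take r) := by
        rw [isSMulRegular_iff_right_eq_zero_of_smul] at hreg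
        have := hreg (Submodule.Quotient.mk 1) (by
          rw [← Submodule.Quotient.mk_smul, Submodule.Quotient.mk_eq_zero]
          simpa using hmem')
        rw [Submodule.Quotient.mk_eq_zero] at this
        simpa using this
      apply hus.top_ne_smul
      have htop : Ideal.ofList us = ⊤ := by
        rw [Ideal.eq_top_iff_one]
        refine Ideal.span_mono ?_ hone
        exact fun x hx => List.mem_of_mem_take hx
      simp [htop]
  exact key us.length le_rfl

variable {k : Type*} [Field k] {d : ℕ}

/-- The `d - 1` independent coefficient vectors span a hyperplane, the kernel of a functional `φ`.
The coordinates of `φ` form the common zero `v`, and the forms `lineForm v i j` have coefficients in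
`ker φ`. -/
theorem exists_ofList_eq_lineIdeal (hd : 1 ≤ d) {us : List (MvPolynomial (Fin d) k)}
    (hlen : us.length = d - 1) (hhom : ∀ u ∈ us, u.IsHomogeneous 1)
    (hus : RingTheory.Sequence.IsRegular (MvPolynomial (Fin d) k) us) :
    ∃ (v : Fin d → k) (i : Fin d), v i ≠ 0 ∧ Ideal.ofList us = lineIdeal v := by
  have hform : ∀ j : Fin us.length, ∃ c : Fin d → k,
      Fintype.linearCombination k (X : Fin d → MvPolynomial (Fin d) k) c = us.get j := by
    intro j
    have h1 : us.get j ∈ homogeneousSubmodule (Fin d) k 1 := hhom _ (List.get_mem us j)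
    rw [homogeneousSubmodule_one_eq_span_X, ← Fintype.range_linearCombination] at h1
    exact h1
  choose c hc using hform
  have hcind : LinearIndependent k c := by
    refine LinearIndependent.of_comp
      (Fintype.linearCombination k (X : Fin d → MvPolynomial (Fin d) k)) ?_
    have h := linearIndependent_of_isRegular (k := k) hus
    rw [← funext hc] at h
    exact h
  have hfin : Module.finrank k (Submodule.span k (Set.range c)) = d - 1 := by
    rw [finrank_span_eq_card hcind, Fintype.card_fin, hlen]
  have hlt : Submodule.span k (Set.range c) < ⊤ := by
    refine lt_top_iff_ne_top.mpr fun h => ?_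
    rw [h, finrank_top, Module.finrank_fin_fun] at hfin
    omega
  obtain ⟨φ, hφ0, hφ⟩ := Submodule.exists_le_ker_of_lt_top _ hlt
  have hφeq : Submodule.span k (Set.range c) = LinearMap.ker φ := by
    refine Submodule.eq_of_le_of_finrank_le hφ ?_
    have := Module.Dual.finrank_ker_add_one_of_ne_zero hφ0
    rw [Module.finrank_fin_fun] at this
    omega
  let v : Fin d → k := fun i => φ (Pi.single i 1)
  have hφv : ∀ w : Fin d → k, φ w = ∑ i, w i * v i := by
    intro w
    conv_lhs => rw [pi_eq_sum_univ' w]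
    simp [v]
  obtain ⟨i, hi⟩ : ∃ i, v i ≠ 0 := by
    by_contra h
    push Not at h
    apply hφ0
    ext w
    simpa using h w
  have hlin : ∀ w, lineHom v (Fintype.linearCombination k
      (X : Fin d → MvPolynomial (Fin d) k) w) = Polynomial.C (φ w) * Polynomial.X := by
    intro w
    rw [Fintype.linearCombination_apply, map_sum, hφv, map_sum, Finset.sum_mul]
    refine Finset.sum_congr rfl fun j _ => ?_
    rw [map_smul, lineHom_X, Polynomial.smul_eq_C_mul, map_mul, mul_assoc]
  refine ⟨v, i, hi, le_antisymm ?_ (lineIdeal_le (i := i) fun j => ?_)⟩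
  · rw [Ideal.ofList, Ideal.span_le]
    intro u hu
    obtain ⟨j, rfl⟩ := List.get_of_mem hu
    rw [SetLike.mem_coe, mem_lineIdeal, ← hc j, hlin]
    have : φ (c j) = 0 := hφ (Submodule.subset_span ⟨j, rfl⟩)
    rw [this, map_zero, zero_mul]
  · have hmem : (Pi.single j 1 - (v j / v i) • Pi.single i 1 : Fin d → k) ∈
        Submodule.span k (Set.range c) := by
      rw [hφeq, LinearMap.mem_ker, map_sub, map_smul, smul_eq_mul]
      change v j - v j / v i * v i = 0
      rw [div_mul_cancel₀ _ hi, sub_self]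
    have hle : Submodule.span k (Set.range c) ≤
        ((Ideal.ofList us).restrictScalars k).comap
          (Fintype.linearCombination k (X : Fin d → MvPolynomial (Fin d) k)) := by
      rw [Submodule.span_le]
      rintro _ ⟨l, rfl⟩
      rw [SetLike.mem_coe, Submodule.mem_comap, hc l]
      exact Ideal.subset_span (List.get_mem us l)
    have := hle hmem
    rw [Submodule.mem_comap, map_sub, map_smul] at this
    simpa [lineForm, smul_eq_C_mul] using this

end LinearForms

/-! ### Associated primes of height `d - 1`. -/

section AssociatedPrimes

variable {k : Type*} [Field k] {d : ℕ} {A : Type*} [CommRing A]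
  [Algebra (MvPolynomial (Fin d) k) A] [Module.Finite (MvPolynomial (Fin d) k) A]

/-- The sequence generates a line ideal, so `P` is the only minimal prime of its extension. Krull's
height theorem bounds the height of `P` above by `d - 1`, and the regular sequence in `A_P` bounds
it below. Any other associated prime strictly contains `P` and has larger height. -/
theorem encard_assHeight_eq_one [Module.Flat (MvPolynomial (Fin d) k) A] (hd : 1 ≤ d)
    (hline : ∀ (v : Fin d → k) (i : Fin d), v i ≠ 0 → ∃ P : Ideal A, P.IsPrime ∧
      P.comap (algebraMap (MvPolynomial (Fin d) k) A) = lineIdeal v ∧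
      ∀ P' : Ideal A, P'.IsPrime →
        lineIdeal v ≤ P'.comap (algebraMap (MvPolynomial (Fin d) k) A) → P ≤ P')
    {us : List (MvPolynomial (Fin d) k)} (hlen : us.length = d - 1)
    (hhom : ∀ u ∈ us, u.IsHomogeneous 1)
    (hus : RingTheory.Sequence.IsRegular (MvPolynomial (Fin d) k) us) :
    (assHeight A (d - 1) (A ⧸ Ideal.ofList (us.map
      (algebraMap (MvPolynomial (Fin d) k) A)))).encard = 1 := by
  have hnoeth := isNoetherianRing_of_finite_mvPolynomial k d A
  obtain ⟨v, i, hi, hv⟩ := exists_ofList_eq_lineIdeal hd hlen hhom hus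
  obtain ⟨P, hPprime, hPv, hPmin⟩ := hline v i hi
  set I : Ideal A := Ideal.ofList (us.map (algebraMap (MvPolynomial (Fin d) k) A)) with hI
  have hImap : I = (lineIdeal v).map (algebraMap (MvPolynomial (Fin d) k) A) := by
    rw [hI, ← Ideal.map_ofList, hv]
  have hIP : ∀ P' : Ideal A, P'.IsPrime → I ≤ P' → P ≤ P' := fun P' hP' h =>
    hPmin P' hP' (by rwa [hImap, Ideal.map_le_iff_le_comap] at h)
  have hPI : P ∈ I.minimalPrimes :=
    ⟨⟨hPprime, by rw [hImap, Ideal.map_le_iff_le_comap, hPv]⟩, fun q hq _ => hIP q hq.1 hq.2⟩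
  have hassoc : P ∈ associatedPrimes A (A ⧸ I) := by
    apply Module.associatedPrimes.minimalPrimes_annihilator_subset_associatedPrimes
    rwa [Ideal.annihilator_quotient]
  have hheight : P.height = ((d - 1 : ℕ) : ℕ∞) := by
    refine le_antisymm ?_ ?_
    · refine (Ideal.height_le_card_of_mem_minimalPrimes_span (List.finite_toSet _) hPI).trans ?_
      rw [← hlen]
      classical
      have := List.toFinset_card_le (us.map (algebraMap (MvPolynomial (Fin d) k) A))
      rw [List.length_map] at this
      rw [← List.coe_toFinset, Set.ncard_coe_finset]
      exact_mod_cast this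
    · have hreg := isRegular_localization_of_flat hus.toIsWeaklyRegular P (fun u hu => by
        rw [← Ideal.mem_comap, hPv, ← hv]
        exact Ideal.subset_span hu)
      have hnoeth' : IsNoetherianRing (Localization.AtPrime P) :=
        IsLocalization.isNoetherianRing P.primeCompl _ hnoeth
      have hgrade := (le_iSup (fun rs : {rs : List (Localization.AtPrime P) //
        (∀ r ∈ rs, r ∈ IsLocalRing.maximalIdeal (Localization.AtPrime P)) ∧
          RingTheory.Sequence.IsRegular (Localization.AtPrime P) rs} => (rs.1.length : ℕ∞))
        ⟨_, fun r hr => ?_, hreg⟩)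
      · have := (WithBot.coe_le_coe.mpr hgrade).trans (grade_maximalIdeal_le_ringKrullDim _)
        rw [IsLocalization.AtPrime.ringKrullDim_eq_height P, WithBot.coe_le_coe] at this
        simpa [hlen] using this
      · obtain ⟨w, hw, rfl⟩ := List.mem_map.mp hr
        rw [IsLocalization.AtPrime.to_map_mem_maximal_iff _ P]
        exact hPI.1.2 (Ideal.subset_span hw)
  rw [Set.encard_eq_one]
  refine ⟨P, Set.eq_singleton_iff_unique_mem.mpr ⟨⟨hassoc, hheight⟩, ?_⟩⟩
  rintro P' ⟨hP', hP'height⟩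
  have hP'prime : P'.IsPrime := IsAssociatedPrime.isPrime hP'
  have hIP' : I ≤ P' := by
    have := IsAssociatedPrime.annihilator_le hP'
    rwa [Submodule.annihilator_top, Ideal.annihilator_quotient] at this
  have hle := hIP P' hP'prime hIP'
  have : P'.FiniteHeight := ⟨Or.inr (by rw [hP'height]; exact ENat.natCast_ne_top _)⟩
  by_contra hne
  have hlt := Ideal.height_strict_mono_of_isPrime (lt_of_le_of_ne hle (Ne.symm hne))
  rw [hheight, hP'height] at hlt
  exact lt_irrefl _ hlt

end AssociatedPrimes

/-! ### Descent of uniqueness to intermediate rings. -/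

section Intermediate

variable {k : Type*} [Field k] {d : ℕ} {R A : Type*} [CommRing R] [CommRing A]
  [Algebra (MvPolynomial (Fin d) k) R] [Algebra (MvPolynomial (Fin d) k) A] [Algebra R A]
  [IsScalarTower (MvPolynomial (Fin d) k) R A] [Algebra.IsIntegral (MvPolynomial (Fin d) k) A]

/-- Each prime of `R` over the line lifts to a prime of `A` over the line. The lift contains `P` and
equals it by incomparability, so every such prime of `R` is the contraction of `P`. -/
theorem eq_of_comap_eq_lineIdeal (hinj : Function.Injective (algebraMap R A))
    (hline : ∀ (v : Fin d → k) (i : Fin d), v i ≠ 0 → ∃ P : Ideal A, P.IsPrime ∧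
      P.comap (algebraMap (MvPolynomial (Fin d) k) A) = lineIdeal v ∧
      ∀ P' : Ideal A, P'.IsPrime →
        lineIdeal v ≤ P'.comap (algebraMap (MvPolynomial (Fin d) k) A) → P ≤ P')
    (v : Fin d → k) (i : Fin d) (hi : v i ≠ 0) (P₁ P₂ : Ideal R) (hP₁ : P₁.IsPrime)
    (hP₂ : P₂.IsPrime) (h₁ : P₁.comap (algebraMap (MvPolynomial (Fin d) k) R) = lineIdeal v)
    (h₂ : P₂.comap (algebraMap (MvPolynomial (Fin d) k) R) = lineIdeal v) : P₁ = P₂ := by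
  have : Algebra.IsIntegral R A := Algebra.IsIntegral.tower_top (R := MvPolynomial (Fin d) k)
  obtain ⟨P, hP, hPv, hPmin⟩ := hline v i hi
  have key : ∀ Q : Ideal R, Q.IsPrime →
      Q.comap (algebraMap (MvPolynomial (Fin d) k) R) = lineIdeal v →
      Q = P.comap (algebraMap R A) := by
    intro Q hQ hQv
    obtain ⟨Q', -, hQ', rfl⟩ := Ideal.exists_ideal_over_prime_of_isIntegral Q (⊥ : Ideal A) (by
      rw [← RingHom.ker_eq_comap_bot, (RingHom.injective_iff_ker_eq_bot _).mp hinj]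
      exact bot_le)
    rw [Ideal.comap_comap, ← IsScalarTower.algebraMap_eq] at hQv
    have hle := hPmin Q' hQ' hQv.ge
    congr 1
    by_contra hne
    have := Ideal.IsIntegral.comap_lt_comap (R := MvPolynomial (Fin d) k)
      (lt_of_le_of_ne hle (Ne.symm hne))
    rw [hPv, hQv] at this
    exact lt_irrefl _ this
  rw [key P₁ hP₁ h₁, key P₂ hP₂ h₂]

end Intermediate

end GradedChow

end

noncomputable section

namespace GradedChow

/-! ### The extension `Y^m = -g` restricted to a line. -/

section RadicalExtension

/-- Under `t ↦ s^m`, `Y ↦ β s^n`, the term `q_j(t) Y^j` involves only exponents congruent to `nj`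
modulo `m`. These residues are distinct for `j < m` because `gcd(m,n) = 1`, so different terms
cannot cancel. -/
theorem C_pow_mul_coeff_eq_zero {k : Type*} [Field k] {m n : ℕ} (hm : 0 < m)
    (hmn : Nat.Coprime m n) (β : k) {q : Polynomial (Polynomial k)} (hq : q.natDegree < m)
    (h : q.eval₂ (Polynomial.expand k m : Polynomial k →+* Polynomial k)
      (Polynomial.C β * Polynomial.X ^ n) = 0) (j : ℕ) :
    Polynomial.C (β ^ j) * q.coeff j = 0 := by
  by_cases hj : j < m
  swap
  · rw [Polynomial.coeff_eq_zero_of_natDegree_lt (by omega), mul_zero]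
  ext i
  have hcoeff : ∀ l, ((Polynomial.expand k m : Polynomial k →+* Polynomial k) (q.coeff l) *
      (Polynomial.C β * Polynomial.X ^ n) ^ l).coeff (m * i + n * j) =
      if n * l ≤ m * i + n * j then
        (if m ∣ m * i + n * j - n * l then (q.coeff l).coeff ((m * i + n * j - n * l) / m) else 0)
          * β ^ l else 0 := by
    intro l
    rw [mul_pow, ← map_pow, ← pow_mul, ← mul_assoc, Polynomial.coeff_mul_X_pow']
    refine if_congr Iff.rfl ?_ rfl
    rw [Polynomial.coeff_mul_C]
    congr 1
    exact Polynomial.coeff_expand hm _ _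
  have h0 := congrArg (fun p => Polynomial.coeff p (m * i + n * j)) h
  simp only [Polynomial.eval₂_eq_sum_range' _ hq, Polynomial.finsetSum_coeff, hcoeff,
    Polynomial.coeff_zero] at h0
  rw [Finset.sum_eq_single j] at h0
  · rw [if_pos (Nat.le_add_left _ _), Nat.add_sub_cancel, if_pos (dvd_mul_right _ _),
      Nat.mul_div_cancel_left _ hm] at h0
    rw [Polynomial.coeff_C_mul, Polynomial.coeff_zero, mul_comm, h0]
  · intro l hl hlj
    rw [Finset.mem_range] at hl
    split_ifs with h1 h2
    · exfalso
      apply hlj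
      have h3 : n * l ≡ m * i + n * j [MOD m] := (Nat.modEq_iff_dvd' h1).mpr h2
      have h4 : m * i + n * j ≡ n * j [MOD m] := by simp [Nat.ModEq]
      have h5 := Nat.ModEq.cancel_left_of_coprime hmn (h3.trans h4)
      rwa [Nat.ModEq, Nat.mod_eq_of_lt hl, Nat.mod_eq_of_lt hj] at h5
    · rw [zero_mul]
    · rfl
  · intro hj'
    exact absurd (Finset.mem_range.mpr hj) hj'

variable {k : Type*} [Field k] {d m n : ℕ} {g : MvPolynomial (Fin d) k}

/-- With `β^m = -c`, the polynomial generates the kernel of the parametrization `t ↦ s^m`, `Y ↦ β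
s^n` into the domain `k[s]`: a remainder in the kernel has all coefficients zero since `β ≠ 0`. -/
theorem prime_X_pow_add_C_mul_X_pow [IsAlgClosed k] (hm : 0 < m) (hmn : Nat.Coprime m n) {c : k}
    (hc : c ≠ 0) : Prime (Polynomial.X ^ m +
      Polynomial.C (Polynomial.C c * Polynomial.X ^ n) : Polynomial (Polynomial k)) := by
  set p : Polynomial (Polynomial k) :=
    Polynomial.X ^ m + Polynomial.C (Polynomial.C c * Polynomial.X ^ n)
  have hp : p.Monic := Polynomial.monic_X_pow_add_C _ hm.ne'
  obtain ⟨β, hβ⟩ := IsAlgClosed.exists_pow_nat_eq (-c) hm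
  have hβ0 : β ≠ 0 := by
    rintro rfl
    rw [zero_pow hm.ne'] at hβ
    exact hc (by simpa using hβ.symm)
  let Ψ := Polynomial.eval₂RingHom (Polynomial.expand k m : Polynomial k →+* Polynomial k)
      (Polynomial.C β * Polynomial.X ^ n)
  have hΨp : Ψ p = 0 := by
    simp only [Ψ, p, Polynomial.coe_eval₂RingHom, Polynomial.eval₂_add, Polynomial.eval₂_pow,
      Polynomial.eval₂_X, Polynomial.eval₂_C, mul_pow, ← map_pow, hβ]
    simp [← pow_mul, mul_comm n m]
  have hker : Ideal.span {p} = RingHom.ker Ψ := by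
    apply le_antisymm
    · rwa [Ideal.span_singleton_le_iff_mem, RingHom.mem_ker]
    · intro q hq
      rw [RingHom.mem_ker, ← Polynomial.modByMonic_add_div q p, map_add, map_mul, hΨp, zero_mul,
        add_zero] at hq
      rw [Ideal.mem_span_singleton, ← Polynomial.modByMonic_eq_zero_iff_dvd hp]
      have hdeg : (q %ₘ p).natDegree < m := by
        have := Polynomial.natDegree_modByMonic_lt q hp (by
          intro h1
          have := congrArg Polynomial.natDegree h1
          rw [Polynomial.natDegree_X_pow_add_C, Polynomial.natDegree_one] at this
          omega)
        rwa [Polynomial.natDegree_X_pow_add_C] at this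
      ext1 j
      have := C_pow_mul_coeff_eq_zero hm hmn β hdeg hq j
      rw [mul_eq_zero] at this
      refine this.resolve_left ?_
      rw [Polynomial.C_eq_zero]
      exact pow_ne_zero _ hβ0
  rw [← Ideal.span_singleton_prime hp.ne_zero, hker]
  exact RingHom.ker_isPrime _

/-- A monic polynomial is irreducible if its restriction to the line through `v` is, and over a
factorial ring irreducible elements are prime. -/
theorem isDomain_adjoinRoot [IsAlgClosed k] (hm : 0 < m) (hmn : Nat.Coprime m n)
    (hg : g.IsHomogeneous n) {v : Fin d → k} (hv : eval v g ≠ 0) :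
    IsDomain (AdjoinRoot (Polynomial.X ^ m + Polynomial.C g)) := by
  refine AdjoinRoot.isDomain_of_prime (Irreducible.prime ?_)
  refine Polynomial.Monic.irreducible_of_irreducible_map
    (lineHom v : MvPolynomial (Fin d) k →+* Polynomial k) _
    (Polynomial.monic_X_pow_add_C _ hm.ne') ?_
  have := (prime_X_pow_add_C_mul_X_pow hm hmn hv).irreducible
  rw [← lineHom_of_isHomogeneous v hg] at this
  simpa using this

/-- `P` is the kernel of the map to `k[s]` parametrizing the curve above the line. For a remainder
`∑ r_j Y^j` in `P`, each `r_j` vanishes on the line or `β^j = 0`; both cases put `r_j Y^j` into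
`P'`. -/
theorem exists_minimal_over_lineIdeal_adjoinRoot [IsAlgClosed k] (hm : 0 < m)
    (hmn : Nat.Coprime m n) (hg : g.IsHomogeneous n) (v : Fin d → k) :
    ∃ P : Ideal (AdjoinRoot (Polynomial.X ^ m + Polynomial.C g)), P.IsPrime ∧
      P.comap (algebraMap (MvPolynomial (Fin d) k) _) = lineIdeal v ∧
      ∀ P' : Ideal (AdjoinRoot (Polynomial.X ^ m + Polynomial.C g)), P'.IsPrime →
        lineIdeal v ≤ P'.comap (algebraMap (MvPolynomial (Fin d) k) _) → P ≤ P' := by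
  set p : Polynomial (MvPolynomial (Fin d) k) := Polynomial.X ^ m + Polynomial.C g with hp_def
  have hp : p.Monic := Polynomial.monic_X_pow_add_C _ hm.ne'
  obtain ⟨β, hβ⟩ := IsAlgClosed.exists_pow_nat_eq (-eval v g) hm
  let E : Polynomial k →+* Polynomial k := (Polynomial.expand k m : Polynomial k →+* Polynomial k)
  let L : MvPolynomial (Fin d) k →+* Polynomial k := lineHom v
  have hroot : p.eval₂ (E.comp L) (Polynomial.C β * Polynomial.X ^ n) = 0 := by
    have hL : L g = Polynomial.C (eval v g) * Polynomial.X ^ n := lineHom_of_isHomogeneous v hg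
    simp only [p, Polynomial.eval₂_add, Polynomial.eval₂_pow, Polynomial.eval₂_X,
      Polynomial.eval₂_C, mul_pow, ← map_pow, hβ, RingHom.comp_apply, hL, E]
    simp [← pow_mul, mul_comm n m]
  let ψ : AdjoinRoot p →+* Polynomial k := AdjoinRoot.lift (E.comp L) _ hroot
  have hE : Function.Injective E := Polynomial.expand_injective hm
  refine ⟨RingHom.ker ψ, RingHom.ker_isPrime _, ?_, fun P' hP' hle => ?_⟩
  · ext f
    rw [Ideal.mem_comap, RingHom.mem_ker, AdjoinRoot.algebraMap_eq, AdjoinRoot.lift_of,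
      RingHom.comp_apply, map_eq_zero_iff E hE, mem_lineIdeal]
    rfl
  · intro a ha
    obtain ⟨q, rfl⟩ := AdjoinRoot.mk_surjective a
    have hmod : AdjoinRoot.mk p q = AdjoinRoot.mk p (q %ₘ p) := by
      conv_lhs => rw [← Polynomial.modByMonic_add_div q p]
      rw [map_add, map_mul, AdjoinRoot.mk_self, zero_mul, add_zero]
    rw [hmod] at ha ⊢
    set r := q %ₘ p
    have hdeg : r.natDegree < m := by
      have := Polynomial.natDegree_modByMonic_lt q hp (by
        intro h1
        have := congrArg Polynomial.natDegree h1
        rw [Polynomial.natDegree_X_pow_add_C, Polynomial.natDegree_one] at this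
        omega)
      rwa [Polynomial.natDegree_X_pow_add_C] at this
    rw [RingHom.mem_ker, AdjoinRoot.lift_mk, ← Polynomial.eval₂_map] at ha
    have hcoeff := C_pow_mul_coeff_eq_zero hm hmn β
      (lt_of_le_of_lt Polynomial.natDegree_map_le hdeg) ha
    rw [Polynomial.as_sum_range_C_mul_X_pow' (p := r) hdeg, map_sum]
    refine P'.sum_mem fun j _ => ?_
    rw [map_mul, map_pow, AdjoinRoot.mk_X, AdjoinRoot.mk_C]
    have hj := hcoeff j
    rw [Polynomial.coeff_map, mul_eq_zero] at hj
    rcases hj with hj | hj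
    -- Here `β = 0`, so `g` vanishes on the line and `Y^m = -g` lies in `P'`; the case `j = 0` is
    -- excluded because `β^0 = 1`.
    · rw [Polynomial.C_eq_zero] at hj
      have hj0 : j ≠ 0 := by
        rintro rfl
        simp at hj
      have hg0 : g ∈ lineIdeal v := by
        rw [mem_lineIdeal, lineHom_of_isHomogeneous v hg]
        rw [pow_eq_zero_iff hj0] at hj
        rw [hj, zero_pow hm.ne'] at hβ
        rw [neg_eq_zero.mp hβ.symm, map_zero, zero_mul]
      have hym : AdjoinRoot.root p ^ m ∈ P' := by
        have h1 : AdjoinRoot.root p ^ m + AdjoinRoot.of p g = 0 := by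
          have := AdjoinRoot.mk_self (f := p)
          rwa [hp_def, map_add, map_pow, AdjoinRoot.mk_X, AdjoinRoot.mk_C] at this
        rw [eq_neg_of_add_eq_zero_left h1]
        exact P'.neg_mem (hle hg0)
      exact P'.mul_mem_left _ (P'.pow_mem_of_mem (hP'.mem_of_pow_mem m hym) j
        (Nat.pos_of_ne_zero hj0))
    · refine P'.mul_mem_right _ ?_
      exact hle (mem_lineIdeal.mpr hj)

end RadicalExtension

end GradedChow

end

noncomputable section

namespace GradedChow

/-! ### The hypersurface as a radical extension of a polynomial ring. -/

section Hypersurface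

/-- `k[X_0, …, X_d]` as a polynomial ring in `X_1 = Y` over the polynomial ring in the other
variables. -/
def hyperEquiv (k : Type*) [Field k] (d : ℕ) :
    MvPolynomial (Fin (d + 1)) k ≃ₐ[k] Polynomial (MvPolynomial (Fin d) k) :=
  (renameEquiv k (finSuccEquiv' (1 : Fin (d + 1)))).trans (optionEquivLeft k (Fin d))

/-- The image of the `j`-th variable in the polynomial ring without `Y`. -/
def hyperCoord (k : Type*) [Field k] (d : ℕ) (j : Fin (d + 1)) : MvPolynomial (Fin d) k :=
  (hyperEquiv k d (X j)).coeff 0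

/-- The polynomial `X^n + X^a Z^b + ∑ W_j^n` in the variables without `Y`. -/
def hyperForm (k : Type*) [Field k] (d n a b : ℕ) : MvPolynomial (Fin d) k :=
  hyperCoord k d 0 ^ n + hyperCoord k d 0 ^ a * hyperCoord k d 2 ^ b +
    ∑ j ∈ Finset.univ.filter (fun j : Fin (d + 1) => 3 ≤ (j : ℕ)), hyperCoord k d j ^ n

variable {k : Type*} [Field k] {d m n a b : ℕ}

@[simp]
theorem hyperEquiv_X_one : hyperEquiv k d (X 1) = Polynomial.X := by
  simp [hyperEquiv]

@[simp]
theorem hyperEquiv_X_succAbove (i : Fin d) :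
    hyperEquiv k d (X ((1 : Fin (d + 1)).succAbove i)) = Polynomial.C (X i) := by
  simp [hyperEquiv]

@[simp]
theorem hyperCoord_succAbove (i : Fin d) :
    hyperCoord k d ((1 : Fin (d + 1)).succAbove i) = X i := by
  simp [hyperCoord]

theorem hyperEquiv_X {j : Fin (d + 1)} (hj : j ≠ 1) :
    hyperEquiv k d (X j) = Polynomial.C (hyperCoord k d j) := by
  obtain ⟨i, rfl⟩ := Fin.exists_succAbove_eq hj
  simp

theorem isHomogeneous_hyperCoord {j : Fin (d + 1)} (hj : j ≠ 1) :
    (hyperCoord k d j).IsHomogeneous 1 := by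
  obtain ⟨i, rfl⟩ := Fin.exists_succAbove_eq hj
  rw [hyperCoord_succAbove]
  exact isHomogeneous_X k i

theorem val_one_of_two_le (hd : 2 ≤ d) : ((1 : Fin (d + 1)) : ℕ) = 1 := by
  rw [Fin.val_one', Nat.mod_eq_of_lt (by omega)]

theorem val_two_of_two_le (hd : 2 ≤ d) : ((2 : Fin (d + 1)) : ℕ) = 2 := by
  change 2 % (d + 1) = 2
  exact Nat.mod_eq_of_lt (by omega)

theorem zero_ne_one_of_two_le (hd : 2 ≤ d) : (0 : Fin (d + 1)) ≠ 1 := fun h => by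
  have := congrArg Fin.val h
  rw [val_one_of_two_le hd] at this
  simp at this

theorem two_ne_one_of_two_le (hd : 2 ≤ d) : (2 : Fin (d + 1)) ≠ 1 := fun h => by
  have := congrArg Fin.val h
  rw [val_one_of_two_le hd, val_two_of_two_le hd] at this
  omega

theorem ne_one_of_three_le (hd : 2 ≤ d) {j : Fin (d + 1)} (hj : 3 ≤ (j : ℕ)) : j ≠ 1 := by
  rintro rfl
  rw [val_one_of_two_le hd] at hj
  omega

theorem hyperEquiv_hyperPoly (hd : 2 ≤ d) :
    hyperEquiv k d (hyperPoly k d m n a b) =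
      Polynomial.X ^ m + Polynomial.C (hyperForm k d n a b) := by
  have hsum : ∑ j ∈ Finset.univ.filter (fun j : Fin (d + 1) => 3 ≤ (j : ℕ)),
      hyperEquiv k d (X j) ^ n = Polynomial.C (∑ j ∈ Finset.univ.filter
        (fun j : Fin (d + 1) => 3 ≤ (j : ℕ)), hyperCoord k d j ^ n) := by
    rw [map_sum]
    refine Finset.sum_congr rfl fun j hj => ?_
    rw [hyperEquiv_X (ne_one_of_three_le hd (Finset.mem_filter.mp hj).2), map_pow]
  simp only [hyperPoly, hyperForm, map_add, map_mul, map_pow, map_sum, hyperEquiv_X_one,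
    hyperEquiv_X (zero_ne_one_of_two_le hd), hyperEquiv_X (two_ne_one_of_two_le hd)] at hsum ⊢
  rw [hsum]
  ring

theorem isHomogeneous_hyperForm (hd : 2 ≤ d) (hab : a + b = n) :
    (hyperForm k d n a b).IsHomogeneous n := by
  have hpow : ∀ (j : Fin (d + 1)) (_ : j ≠ 1) (e : ℕ), (hyperCoord k d j ^ e).IsHomogeneous e :=
    fun j hj e => by simpa using (isHomogeneous_hyperCoord (k := k) hj).pow e
  refine ((hpow _ (zero_ne_one_of_two_le hd) n).add ?_).add ?_
  · rw [← hab]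
    exact (hpow _ (zero_ne_one_of_two_le hd) a).mul (hpow _ (two_ne_one_of_two_le hd) b)
  · exact IsHomogeneous.sum _ _ _ fun j hj =>
      hpow j (ne_one_of_three_le hd (Finset.mem_filter.mp hj).2) n

theorem exists_eval_hyperForm_ne_zero (hd : 2 ≤ d) (hn : n ≠ 0) (hb : b ≠ 0) :
    ∃ v, eval v (hyperForm k d n a b) ≠ 0 := by
  -- The point with `X = 1` and all other coordinates `0`, where the form takes the value `1`.
  let v : Fin d → k := fun i => if (i : ℕ) = 0 then 1 else 0
  have hv : ∀ j : Fin (d + 1), j ≠ 1 →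
      eval v (hyperCoord k d j) = if (j : ℕ) = 0 then 1 else 0 := by
    intro j hj
    obtain ⟨i, rfl⟩ := Fin.exists_succAbove_eq hj
    rw [hyperCoord_succAbove, eval_X]
    refine if_congr ?_ rfl rfl
    rw [Fin.succAbove]
    split_ifs with h <;> rw [Fin.lt_def, val_one_of_two_le hd, Fin.val_castSucc] at h
    · simp
    · simp
      omega
  refine ⟨v, ?_⟩
  rw [hyperForm, map_add, map_add, map_pow, map_mul, map_pow, map_pow, map_sum,
    hv _ (zero_ne_one_of_two_le hd), hv _ (two_ne_one_of_two_le hd), val_two_of_two_le hd,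
    Finset.sum_eq_zero]
  · simp [zero_pow hb]
  · intro j hj
    have hj3 := (Finset.mem_filter.mp hj).2
    rw [map_pow, hv j (ne_one_of_three_le hd hj3), if_neg (by omega), zero_pow hn]

variable (k d m n a b) in
/-- The hypersurface ring as an algebra over the polynomial ring in all variables but `Y`. -/
@[reducible]
def hyperAlgebra : Algebra (MvPolynomial (Fin d) k) (HyperRing k d m n a b) :=
  (aeval (hyperParam k d m n a b)).toRingHom.toAlgebra

attribute [local instance] hyperAlgebra

variable (k d m n a b) in
/-- The module structure underlying `hyperAlgebra`. -/
@[reducible]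
def hyperModule : Module (MvPolynomial (Fin d) k) (HyperRing k d m n a b) :=
  (hyperAlgebra k d m n a b).toModule

attribute [local instance] hyperModule

theorem algebraMap_hyper (f : MvPolynomial (Fin d) k) :
    algebraMap (MvPolynomial (Fin d) k) (HyperRing k d m n a b) f =
      aeval (hyperParam k d m n a b) f := rfl

variable (k m n a b) in
/-- The hypersurface ring is obtained from the polynomial ring without `Y` by adjoining `Y`. -/
def hyperAdjoinRootEquiv (hd : 2 ≤ d) : HyperRing k d m n a b ≃ₐ[MvPolynomial (Fin d) k]
    AdjoinRoot (Polynomial.X ^ m + Polynomial.C (hyperForm k d n a b)) := by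
  let E : HyperRing k d m n a b ≃+*
      AdjoinRoot (Polynomial.X ^ m + Polynomial.C (hyperForm k d n a b)) :=
    Ideal.quotientEquiv (Ideal.span {hyperPoly k d m n a b})
      (Ideal.span {Polynomial.X ^ m + Polynomial.C (hyperForm k d n a b)})
      (hyperEquiv k d).toRingEquiv (by
        rw [Ideal.map_span, Set.image_singleton, ← hyperEquiv_hyperPoly hd]
        rfl)
  refine AlgEquiv.ofRingEquiv (f := E) fun f => ?_
  have hmk : ∀ q, E (Ideal.Quotient.mk _ q) = AdjoinRoot.mk _ (hyperEquiv k d q) := fun _ => rfl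
  have key : E.toRingHom.comp (algebraMap (MvPolynomial (Fin d) k) _) =
      algebraMap (MvPolynomial (Fin d) k) _ := by
    refine MvPolynomial.ringHom_ext (fun c => ?_) fun i => ?_
    · rw [RingHom.comp_apply, algebraMap_hyper, algHom_C]
      change E (Ideal.Quotient.mk _ (C c)) = _
      rw [hmk, ← algebraMap_eq, AlgEquiv.commutes]
      rfl
    · rw [RingHom.comp_apply, algebraMap_hyper, aeval_X]
      change E (Ideal.Quotient.mk _ (X _)) = _
      rw [hmk, hyperEquiv_X_succAbove]
      rfl
  exact DFunLike.congr_fun key f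

theorem module_finite_hyper (hd : 2 ≤ d) (hm : 0 < m) :
    Module.Finite (MvPolynomial (Fin d) k) (HyperRing k d m n a b) :=
  have : Module.Finite (MvPolynomial (Fin d) k)
      (AdjoinRoot (Polynomial.X ^ m + Polynomial.C (hyperForm k d n a b))) :=
    (Polynomial.monic_X_pow_add_C _ hm.ne').finite_adjoinRoot
  Module.Finite.equiv (hyperAdjoinRootEquiv k m n a b hd).symm.toLinearEquiv

theorem module_free_hyper (hd : 2 ≤ d) (hm : 0 < m) :
    Module.Free (MvPolynomial (Fin d) k) (HyperRing k d m n a b) :=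
  have : Module.Free (MvPolynomial (Fin d) k)
      (AdjoinRoot (Polynomial.X ^ m + Polynomial.C (hyperForm k d n a b))) :=
    (Polynomial.monic_X_pow_add_C _ hm.ne').free_adjoinRoot
  Module.Free.of_equiv (hyperAdjoinRootEquiv k m n a b hd).symm.toLinearEquiv

theorem isDomain_hyper [IsAlgClosed k] (hd : 2 ≤ d) (hm : 0 < m) (hn : n ≠ 0) (hb : b ≠ 0)
    (hmn : Nat.Coprime m n) (hab : a + b = n) : IsDomain (HyperRing k d m n a b) := by
  obtain ⟨v, hv⟩ := exists_eval_hyperForm_ne_zero (k := k) (a := a) hd hn hb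
  have := isDomain_adjoinRoot hm hmn (isHomogeneous_hyperForm hd hab) hv
  exact (hyperAdjoinRootEquiv k m n a b hd).toMulEquiv.isDomain _

theorem exists_minimal_over_lineIdeal_hyper [IsAlgClosed k] (hd : 2 ≤ d) (hm : 0 < m)
    (hmn : Nat.Coprime m n) (hab : a + b = n) (v : Fin d → k) :
    ∃ P : Ideal (HyperRing k d m n a b), P.IsPrime ∧
      P.comap (algebraMap (MvPolynomial (Fin d) k) _) = lineIdeal v ∧
      ∀ P' : Ideal (HyperRing k d m n a b), P'.IsPrime →
        lineIdeal v ≤ P'.comap (algebraMap (MvPolynomial (Fin d) k) _) → P ≤ P' := by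
  obtain ⟨P, hP, hPv, hmin⟩ :=
    exists_minimal_over_lineIdeal_adjoinRoot hm hmn (isHomogeneous_hyperForm (k := k) hd hab) v
  let E := hyperAdjoinRootEquiv k m n a b hd
  refine ⟨P.comap E, hP.comap _, ?_, fun P' hP' hle => ?_⟩
  · rw [← hPv]
    ext f
    rw [Ideal.mem_comap, Ideal.mem_comap, Ideal.mem_comap, AlgEquiv.commutes]
  · have h := hmin (P'.comap E.symm) (hP'.comap _) (fun f hf => by
      rw [Ideal.mem_comap, Ideal.mem_comap, AlgEquiv.commutes]
      exact hle hf)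
    intro x hx
    have := h hx
    rwa [Ideal.mem_comap, AlgEquiv.symm_apply_apply] at this

end Hypersurface

end GradedChow

end

noncomputable section

namespace GradedChow

/-! ### The grading induced on a quotient by a weighted homogeneous ideal. -/

section QuotientGrading

variable {k : Type*} [Field k] {σ : Type*}

theorem gradedMonoid_map_mk (w : σ → ℕ) (I : Ideal (MvPolynomial σ k)) :
    SetLike.GradedMonoid fun i =>
      (weightedHomogeneousSubmodule k w i).map (Ideal.Quotient.mkₐ k I).toLinearMap where
  one_mem := ⟨1, isWeightedHomogeneous_one k w, map_one (Ideal.Quotient.mkₐ k I)⟩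
  mul_mem := by
    rintro i j _ _ ⟨p, hp, rfl⟩ ⟨q, hq, rfl⟩
    exact ⟨p * q, IsWeightedHomogeneous.mul hp hq, map_mul (Ideal.Quotient.mkₐ k I) p q⟩

/-- Independence: lift a vanishing sum to weighted homogeneous polynomials; their sum lies in `I`,
hence so does each of them. -/
theorem isInternal_map_mk (w : σ → ℕ) (I : Ideal (MvPolynomial σ k))
    (hI : ∀ p ∈ I, ∀ i, weightedHomogeneousComponent w i p ∈ I) :
    DirectSum.IsInternal fun i =>
      (weightedHomogeneousSubmodule k w i).map (Ideal.Quotient.mkₐ k I).toLinearMap := by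
  classical
  refine ⟨(injective_iff_map_eq_zero _).mpr fun x hx => ?_, fun r => ?_⟩
  · have hex : ∀ i, ∃ p : MvPolynomial σ k, IsWeightedHomogeneous w p i ∧
        Ideal.Quotient.mk I p = (x i : MvPolynomial σ k ⧸ I) := fun i => by
      obtain ⟨p, hp, hpx⟩ := (x i).2
      exact ⟨p, hp, hpx⟩
    choose p hp hpx using hex
    have hsum : ∑ i ∈ DFinsupp.support x, p i ∈ I := by
      rw [← Ideal.Quotient.eq_zero_iff_mem, map_sum]
      rw [DirectSum.coeAddMonoidHom_eq_dfinsuppSum, DFinsupp.sum] at hx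
      rw [← hx]
      exact Finset.sum_congr rfl fun i _ => hpx i
    ext i
    by_cases hi : i ∈ DFinsupp.support x
    · have := hI _ hsum i
      rw [map_sum, Finset.sum_eq_single i (fun j _ hj =>
        (hp j).weightedHomogeneousComponent_ne i (Ne.symm hj)) (fun h => absurd hi h),
        (hp i).weightedHomogeneousComponent_same] at this
      rw [← hpx i, Ideal.Quotient.eq_zero_iff_mem.mpr this]
      rfl
    · rw [DFinsupp.notMem_support_iff.mp hi]
      rfl
  · obtain ⟨p, rfl⟩ := Ideal.Quotient.mk_surjective r
    rw [← sum_weightedHomogeneousComponent w p,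
      finsum_eq_sum _ (weightedHomogeneousComponent_finsupp p), map_sum]
    rw [← AddMonoidHom.mem_mrange]
    refine sum_mem fun i _ => ?_
    refine ⟨DirectSum.of (fun i => (weightedHomogeneousSubmodule k w i).map
      (Ideal.Quotient.mkₐ k I).toLinearMap) i ⟨_, _, weightedHomogeneousComponent_mem w p i, rfl⟩, ?_⟩
    rw [DirectSum.coeAddMonoidHom_of]
    rfl

end QuotientGrading

/-! ### Comparison of gradings. -/

section GradedAlgebraLemmas

variable {k A : Type*} [Field k] [CommRing A] [Algebra k A] {d m : ℕ}

theorem aeval_mem_of_isHomogeneous (𝒜 : ℕ → Submodule k A) [GradedAlgebra 𝒜] {x : Fin d → A}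
    (hx : ∀ i, x i ∈ 𝒜 m) {f : MvPolynomial (Fin d) k} {i : ℕ} (hf : f.IsHomogeneous i) :
    aeval x f ∈ 𝒜 (m * i) := by
  rw [aeval_def, eval₂_eq']
  refine Submodule.sum_mem _ fun e he => ?_
  rw [← Algebra.smul_def]
  refine Submodule.smul_mem _ _ ?_
  have hdeg : ∑ j, e j = i := by
    rw [← hf (mem_support_iff.mp he), Finsupp.weight_apply, Finsupp.sum_fintype] <;> simp
  have := SetLike.prod_pow_mem_graded 𝒜 (F := Finset.univ) (fun _ : Fin d => m) x e
    (fun j _ => hx j)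
  convert this using 2
  rw [← hdeg, Finset.mul_sum]
  exact Finset.sum_congr rfl fun j _ => by rw [smul_eq_mul, mul_comm]

theorem isHomogeneous_of_algebraMap_mem [Algebra (MvPolynomial (Fin d) k) A]
    (𝒜 : ℕ → Submodule k A) [GradedAlgebra 𝒜] (hm : 0 < m)
    (hinj : Function.Injective (algebraMap (MvPolynomial (Fin d) k) A))
    (hdeg : ∀ (f : MvPolynomial (Fin d) k) (i : ℕ), f.IsHomogeneous i →
      algebraMap (MvPolynomial (Fin d) k) A f ∈ 𝒜 (m * i))
    {f : MvPolynomial (Fin d) k} {i : ℕ}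
    (hf : algebraMap (MvPolynomial (Fin d) k) A f ∈ 𝒜 (m * i)) : f.IsHomogeneous i := by
  rw [← sum_homogeneousComponent f]
  refine IsHomogeneous.sum _ _ _ fun j _ => ?_
  by_cases hj : j = i
  · rw [hj]
    exact homogeneousComponent_isHomogeneous i f
  · have h0 := algebraMap_homogeneousComponent_mem 𝒜 hm hdeg f j
    rw [DirectSum.decompose_of_mem_ne 𝒜 hf fun h =>
      hj (Nat.eq_of_mul_eq_mul_left hm h).symm] at h0
    rw [(map_eq_zero_iff _ hinj).mp h0.symm]
    exact isHomogeneous_zero _ _ _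

/-- By uniqueness of homogeneous components, the inclusions `ℛ i ⊆ 𝒜 i` already force `ℛ i = R ∩ 𝒜
i`. -/
theorem mem_of_coe_mem (𝒜 : ℕ → Submodule k A) [GradedAlgebra 𝒜] (R : Subalgebra k A)
    (ℛ : ℕ → Submodule k R) [GradedAlgebra ℛ] (h : ∀ (i : ℕ) (r : R), r ∈ ℛ i → (r : A) ∈ 𝒜 i)
    {r : R} {i : ℕ} (hr : (r : A) ∈ 𝒜 i) : r ∈ ℛ i := by
  have key : ∀ (s : R) (j : ℕ), GradedRing.proj 𝒜 j (s : A) = (GradedRing.proj ℛ j s : R) := by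
    intro s j
    induction s using DirectSum.Decomposition.inductionOn ℛ with
    | zero => simp
    | @homogeneous l s =>
      by_cases hl : l = j
      · subst hl
        rw [GradedRing.proj_apply, GradedRing.proj_apply,
          DirectSum.decompose_of_mem_same 𝒜 (h _ _ s.2), DirectSum.decompose_of_mem_same ℛ s.2]
      · rw [GradedRing.proj_apply, GradedRing.proj_apply,
          DirectSum.decompose_of_mem_ne 𝒜 (h _ _ s.2) hl, DirectSum.decompose_of_mem_ne ℛ s.2 hl]
        rfl
    | add s t hs ht =>
      rw [map_add, Subalgebra.coe_add, map_add, hs, ht, Subalgebra.coe_add]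
  have h1 := key r i
  rw [GradedRing.proj_apply, GradedRing.proj_apply, DirectSum.decompose_of_mem_same 𝒜 hr] at h1
  rw [Subtype.ext h1]
  exact SetLike.coe_mem _

end GradedAlgebraLemmas

/-! ### Transport between `T ⊆ A` and the abstract polynomial ring. -/

section Subalg

variable {k A : Type*} [Field k] [CommRing A] [Algebra k A] {d m : ℕ} {x : Fin d → A}
  [Algebra (MvPolynomial (Fin d) k) A]

theorem algebraMap_aevalEquiv_symm (halg : AlgebraicIndependent k x)
    (hx : ∀ f, algebraMap (MvPolynomial (Fin d) k) A f = aeval x f) (u : subalg k x) :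
    algebraMap (MvPolynomial (Fin d) k) A (halg.aevalEquiv.symm u) = u := by
  rw [hx, ← halg.algebraMap_aevalEquiv, AlgEquiv.apply_symm_apply]
  rfl

theorem module_finite_subalg [Module.Finite (MvPolynomial (Fin d) k) A]
    (halg : AlgebraicIndependent k x)
    (hx : ∀ f, algebraMap (MvPolynomial (Fin d) k) A f = aeval x f) :
    Module.Finite (subalg k x) A :=
  Module.Finite.of_equiv_equiv (A₁ := MvPolynomial (Fin d) k) (B₁ := A)
    halg.aevalEquiv.toRingEquiv (RingEquiv.refl _)
    (RingHom.ext fun f => (halg.algebraMap_aevalEquiv f).trans (hx f).symm)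

theorem isHomogeneous_aevalEquiv_symm (𝒜 : ℕ → Submodule k A) [GradedAlgebra 𝒜] (hm : 0 < m)
    (halg : AlgebraicIndependent k x)
    (hx : ∀ f, algebraMap (MvPolynomial (Fin d) k) A f = aeval x f) (hxm : ∀ i, x i ∈ 𝒜 m)
    {u : subalg k x} (hu : (u : A) ∈ 𝒜 m) : (halg.aevalEquiv.symm u).IsHomogeneous 1 := by
  refine isHomogeneous_of_algebraMap_mem 𝒜 hm (fun f g hfg => halg ?_) (fun f i hf => ?_) ?_
  · rwa [hx, hx] at hfg
  · rw [hx]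
    exact aeval_mem_of_isHomogeneous 𝒜 hxm hf
  · rwa [algebraMap_aevalEquiv_symm halg hx, mul_one]

theorem encard_assHeight_subalg_eq_one [Module.Finite (MvPolynomial (Fin d) k) A]
    [Module.Flat (MvPolynomial (Fin d) k) A] (𝒜 : ℕ → Submodule k A) [GradedAlgebra 𝒜]
    (hm : 0 < m) (halg : AlgebraicIndependent k x)
    (hx : ∀ f, algebraMap (MvPolynomial (Fin d) k) A f = aeval x f) (hxm : ∀ i, x i ∈ 𝒜 m)
    (hd : 1 ≤ d)
    (hline : ∀ (v : Fin d → k) (i : Fin d), v i ≠ 0 → ∃ P : Ideal A, P.IsPrime ∧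
      P.comap (algebraMap (MvPolynomial (Fin d) k) A) = lineIdeal v ∧
      ∀ P' : Ideal A, P'.IsPrime →
        lineIdeal v ≤ P'.comap (algebraMap (MvPolynomial (Fin d) k) A) → P ≤ P')
    (us : List (subalg k x)) (hlen : us.length = d - 1) (hhom : ∀ u ∈ us, (u : A) ∈ 𝒜 m)
    (hus : RingTheory.Sequence.IsRegular (subalg k x) us) :
    (assHeight A (d - 1)
      (A ⧸ Ideal.ofList (us.map fun u : subalg k x => (u : A)))).encard = 1 := by
  have hmap : us.map (fun u : subalg k x => (u : A)) =
      (us.map halg.aevalEquiv.symm).map (algebraMap (MvPolynomial (Fin d) k) A) := by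
    rw [List.map_map]
    exact List.map_congr_left fun u _ => (algebraMap_aevalEquiv_symm halg hx u).symm
  rw [hmap]
  refine encard_assHeight_eq_one hd hline (by rw [List.length_map, hlen]) ?_ ?_
  · intro f hf
    obtain ⟨u, hu, rfl⟩ := List.mem_map.mp hf
    exact isHomogeneous_aevalEquiv_symm 𝒜 hm halg hx hxm (hhom u hu)
  · refine (halg.aevalEquiv.symm.toAddEquiv.isRegular_congr ?_).mp hus
    exact List.forall₂_map_right_iff.mpr (List.forall₂_same.mpr fun r _ y =>
      map_mul halg.aevalEquiv.symm r y)

/-- In a domain only properness needs an argument: a linear form has constant coefficient `0`, so it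
is not a unit. -/
theorem isRegular_singleton_subalg [IsDomain A] (𝒜 : ℕ → Submodule k A) [GradedAlgebra 𝒜]
    (hm : 0 < m) (halg : AlgebraicIndependent k x)
    (hx : ∀ f, algebraMap (MvPolynomial (Fin d) k) A f = aeval x f) (hxm : ∀ i, x i ∈ 𝒜 m)
    {u : subalg k x} (hu : (u : A) ∈ 𝒜 m) (hu0 : u ≠ 0) :
    RingTheory.Sequence.IsRegular (subalg k x) [u] := by
  refine ⟨(RingTheory.Sequence.isWeaklyRegular_singleton_iff _ _).mpr ?_, fun htop => ?_⟩
  · rw [isSMulRegular_iff_right_eq_zero_of_smul]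
    exact fun y hy => (mul_eq_zero.mp hy).resolve_left hu0
  · have hunit : IsUnit u := by
      rw [Ideal.ofList_singleton, smul_eq_mul, Ideal.mul_top] at htop
      exact Ideal.span_singleton_eq_top.mp htop.symm
    have h0 : constantCoeff (halg.aevalEquiv.symm u) = 0 := by
      rw [constantCoeff_eq]
      exact (isHomogeneous_aevalEquiv_symm 𝒜 hm halg hx hxm hu).coeff_eq_zero (by simp)
    exact ((hunit.map halg.aevalEquiv.symm).map (constantCoeff (R := k) (σ := Fin d))).ne_zero h0

theorem isAddTorsion_chowGroup_of_subalg_le [IsAlgClosed k]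
    [Module.Finite (MvPolynomial (Fin d) k) A] [IsDomain A]
    (𝒜 : ℕ → Submodule k A) [GradedAlgebra 𝒜]
    (hm : 0 < m) (halg : AlgebraicIndependent k x)
    (hx : ∀ f, algebraMap (MvPolynomial (Fin d) k) A f = aeval x f) (hxm : ∀ i, x i ∈ 𝒜 m)
    (hd : 2 ≤ d)
    (hline : ∀ (v : Fin d → k) (i : Fin d), v i ≠ 0 → ∃ P : Ideal A, P.IsPrime ∧
      P.comap (algebraMap (MvPolynomial (Fin d) k) A) = lineIdeal v ∧
      ∀ P' : Ideal A, P'.IsPrime →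
        lineIdeal v ≤ P'.comap (algebraMap (MvPolynomial (Fin d) k) A) → P ≤ P')
    (R : Subalgebra k A) (ℛ : ℕ → Submodule k R) [GradedAlgebra ℛ]
    (hTR : subalg k x ≤ R) (hgr : ∀ (i : ℕ) (r : R), r ∈ ℛ i → (r : A) ∈ 𝒜 i) :
    IsAddTorsion (GradedChowGroup ℛ 1) ∧ (d = 2 → IsAddTorsion (ChowGroup R 1)) := by
  let y : Fin d → R := fun i => ⟨x i, hTR (Algebra.subset_adjoin ⟨i, rfl⟩)⟩
  let : Algebra (MvPolynomial (Fin d) k) R := (aeval y).toRingHom.toAlgebra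
  have hval : ∀ f, ((algebraMap (MvPolynomial (Fin d) k) R f : R) : A) =
      algebraMap (MvPolynomial (Fin d) k) A f := by
    intro f
    have : R.val.comp (aeval y) = aeval x := by
      ext i
      simp [y]
    rw [hx, ← this]
    rfl
  have : IsScalarTower (MvPolynomial (Fin d) k) R A :=
    IsScalarTower.of_algebraMap_eq fun f => (hval f).symm
  have hnoethT : IsNoetherian (MvPolynomial (Fin d) k) A := inferInstance
  -- `R` is a submodule of the finite module `A` over a Noetherian ring.
  have hfinR : Module.Finite (MvPolynomial (Fin d) k) R :=
    Module.Finite.of_injective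
      (IsScalarTower.toAlgHom (MvPolynomial (Fin d) k) R A).toLinearMap Subtype.val_injective
  have hnoeth := isNoetherianRing_of_finite_mvPolynomial k d R
  have hinjR : Function.Injective (algebraMap (MvPolynomial (Fin d) k) R) := fun f g hfg =>
    halg (by rw [← hx, ← hx, ← hval, ← hval, hfg])
  have hdeg : ∀ (f : MvPolynomial (Fin d) k) (i : ℕ), f.IsHomogeneous i →
      algebraMap (MvPolynomial (Fin d) k) R f ∈ ℛ (m * i) := fun f i hf =>
    aeval_mem_of_isHomogeneous ℛ (fun i => mem_of_coe_mem 𝒜 R ℛ hgr (hxm i)) hf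
  have huniq := eq_of_comap_eq_lineIdeal (k := k) (d := d) (R := R) (A := A)
    Subtype.val_injective hline
  refine ⟨isAddTorsion_gradedChowGroup ℛ hd hm hinjR hdeg huniq, fun hd2 => ?_⟩
  refine isAddTorsion_chowGroup ℛ hd hm ?_ hinjR hdeg huniq
  rw [ringKrullDim_of_finite_mvPolynomial hinjR, hd2]

end Subalg

/-! ### Grading and Noether normalization of the hypersurface. -/

section HyperGrading

variable {k : Type*} [Field k] {d m n a b : ℕ}

attribute [local instance] hyperAlgebra hyperModule

theorem isWeightedHomogeneous_hyperPoly (hd : 2 ≤ d) (hab : a + b = n) :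
    IsWeightedHomogeneous (hyperWeight d m n) (hyperPoly k d m n a b) (n * m) := by
  have hX : ∀ j : Fin (d + 1), j ≠ 1 → ∀ e : ℕ, IsWeightedHomogeneous (hyperWeight d m n)
      (X j ^ e : MvPolynomial (Fin (d + 1)) k) (e * m) := fun j hj e => by
    have := (isWeightedHomogeneous_X k (hyperWeight d m n) j).pow e
    rwa [hyperWeight, if_neg hj] at this
  refine (((hX _ (zero_ne_one_of_two_le hd) n).add ?_).add ?_).add ?_
  · have := (isWeightedHomogeneous_X k (hyperWeight d m n) 1).pow m
    rwa [hyperWeight, if_pos rfl, smul_eq_mul, mul_comm m n] at this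
  · rw [← hab, add_mul]
    have h1 := hX _ (zero_ne_one_of_two_le hd) a
    have h2 := hX _ (two_ne_one_of_two_le hd) b
    rw [← hab] at h1 h2
    exact h1.mul h2
  · exact IsWeightedHomogeneous.sum _ _ _ fun j hj =>
      hX j (ne_one_of_three_le hd (Finset.mem_filter.mp hj).2) n

theorem isInternal_hyperGrading (hd : 2 ≤ d) (hab : a + b = n) :
    DirectSum.IsInternal (hyperGrading k d m n a b) := by
  classical
  let := weightedGradedAlgebra k (hyperWeight d m n)
  have hI : (Ideal.span {hyperPoly k d m n a b}).IsHomogeneous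
      (weightedHomogeneousSubmodule k (hyperWeight d m n)) := by
    refine Ideal.homogeneous_span _ _ ?_
    rintro _ rfl
    exact ⟨_, isWeightedHomogeneous_hyperPoly hd hab⟩
  exact isInternal_map_mk (hyperWeight d m n) _ fun p hp i =>
    weightedHomogeneousComponent_mem_of_mem k (hyperWeight d m n) hI hp i

variable (k m n a b) in
/-- The hypersurface ring with the grading induced by the weights of the variables. -/
@[reducible]
def hyperGradedAlgebra (hd : 2 ≤ d) (hab : a + b = n) :
    GradedAlgebra (hyperGrading k d m n a b) :=
  { gradedMonoid_map_mk (hyperWeight d m n) (Ideal.span {hyperPoly k d m n a b}) with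
    toDecomposition := (isInternal_hyperGrading hd hab).chooseDecomposition }

theorem mem_hyperGrading_zero (hm : m ≠ 0) (hn : n ≠ 0) (r : HyperRing k d m n a b) :
    r ∈ hyperGrading k d m n a b 0 ↔ ∃ c : k, algebraMap k (HyperRing k d m n a b) c = r := by
  constructor
  · rintro ⟨p, hp, rfl⟩
    refine ⟨coeff 0 p, ?_⟩
    have hw : ∀ j, hyperWeight d m n j ≠ 0 := fun j => by
      rw [hyperWeight]
      split_ifs <;> assumption
    have h1 := weightedHomogeneousComponent_zero (w := hyperWeight d m n) p hw
    rw [IsWeightedHomogeneous.weightedHomogeneousComponent_same hp] at h1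
    conv_rhs => rw [h1]
    rfl
  · rintro ⟨c, rfl⟩
    exact ⟨C c, isWeightedHomogeneous_C _ c, rfl⟩

theorem hyperParam_mem (i : Fin d) :
    hyperParam k d m n a b i ∈ hyperGrading k d m n a b m := by
  refine ⟨X ((1 : Fin (d + 1)).succAbove i), ?_, rfl⟩
  have := isWeightedHomogeneous_X k (hyperWeight d m n) ((1 : Fin (d + 1)).succAbove i)
  rwa [hyperWeight, if_neg (Fin.succAbove_ne 1 i)] at this

theorem algebraMap_hyper_injective (hd : 2 ≤ d) (hm : 0 < m) :
    Function.Injective (algebraMap (MvPolynomial (Fin d) k) (HyperRing k d m n a b)) := by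
  have := module_free_hyper (k := k) (n := n) (a := a) (b := b) hd hm
  have : Nontrivial (HyperRing k d m n a b) := by
    have : Nontrivial (AdjoinRoot (Polynomial.X ^ m + Polynomial.C (hyperForm k d n a b))) := by
      refine AdjoinRoot.nontrivial _ ?_
      rw [Polynomial.degree_X_pow_add_C hm]
      exact_mod_cast hm.ne'
    exact (hyperAdjoinRootEquiv k m n a b hd).toEquiv.nontrivial
  exact FaithfulSMul.algebraMap_injective _ _

theorem isNoetherNormalization_hyper (hd : 2 ≤ d) (hm : 0 < m) :
    IsNoetherNormalization (hyperGrading k d m n a b) (hyperParam k d m n a b) m :=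
  have := module_finite_hyper (k := k) (n := n) (a := a) (b := b) hd hm
  ⟨algebraMap_hyper_injective hd hm,
    module_finite_subalg (algebraMap_hyper_injective hd hm) algebraMap_hyper, hyperParam_mem⟩

end HyperGrading

/-! ### Assembly for the hypersurface. -/

section HyperChow

variable {k : Type*} [Field k] {d m n a b : ℕ}

attribute [local instance] hyperAlgebra hyperModule

theorem isAddTorsion_hyper [IsAlgClosed k] (hd : 2 ≤ d) (hm : 0 < m)
    (hmn : Nat.Coprime m n) (hab : a + b = n) [IsDomain (HyperRing k d m n a b)]
    [GradedAlgebra (hyperGrading k d m n a b)]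
    (R : Subalgebra k (HyperRing k d m n a b)) (ℛ : ℕ → Submodule k R) [GradedAlgebra ℛ]
    (hTR : subalg k (hyperParam k d m n a b) ≤ R)
    (hgr : ∀ (i : ℕ) (r : R), r ∈ ℛ i →
      (r : HyperRing k d m n a b) ∈ hyperGrading k d m n a b i) :
    IsAddTorsion (GradedChowGroup ℛ 1) ∧ (d = 2 → IsAddTorsion (ChowGroup R 1)) :=
  have := module_finite_hyper (k := k) (n := n) (a := a) (b := b) hd hm
  isAddTorsion_chowGroup_of_subalg_le (hyperGrading k d m n a b) hm
    (algebraMap_hyper_injective hd hm) algebraMap_hyper hyperParam_mem hd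
    (fun v _ _ => exists_minimal_over_lineIdeal_hyper hd hm hmn hab v) R ℛ hTR hgr

theorem hypDimD_hyper [IsAlgClosed k] (hd : 2 ≤ d) (hm : 0 < m) (hn : n ≠ 0)
    (hmn : Nat.Coprime m n) (hab : a + b = n) [GradedAlgebra (hyperGrading k d m n a b)] :
    HypDimD (hyperGrading k d m n a b) (hyperParam k d m n a b) m where
  finiteType := inferInstance
  degree_zero := mem_hyperGrading_zero hm.ne' hn
  two_le := hd
  dim := by
    have := module_finite_hyper (k := k) (n := n) (a := a) (b := b) hd hm
    exact ringKrullDim_of_finite_mvPolynomial (algebraMap_hyper_injective hd hm)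
  cohenMacaulay := by
    have := module_finite_hyper (k := k) (n := n) (a := a) (b := b) hd hm
    have := module_free_hyper (k := k) (n := n) (a := a) (b := b) hd hm
    have : Nontrivial (HyperRing k d m n a b) :=
      (algebraMap_hyper_injective (k := k) (n := n) (a := a) (b := b) hd hm).nontrivial
    exact isCohenMacaulay_of_free_mvPolynomial (k := k) (d := d)
  normalization := isNoetherNormalization_hyper hd hm
  ass := by
    have := module_finite_hyper (k := k) (n := n) (a := a) (b := b) hd hm
    have := module_free_hyper (k := k) (n := n) (a := a) (b := b) hd hm
    exact encard_assHeight_subalg_eq_one _ hm (algebraMap_hyper_injective hd hm)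
      algebraMap_hyper hyperParam_mem (by omega)
      fun v _ _ => exists_minimal_over_lineIdeal_hyper hd hm hmn hab v

theorem hypDimTwo_hyper [IsAlgClosed k] (hm : 0 < m) (hn : n ≠ 0)
    (hmn : Nat.Coprime m n) (hab : a + b = n) [IsDomain (HyperRing k 2 m n a b)]
    [GradedAlgebra (hyperGrading k 2 m n a b)] :
    HypDimTwo (hyperGrading k 2 m n a b) (hyperParam k 2 m n a b) m where
  isDomain := inferInstance
  finiteType := inferInstance
  degree_zero := mem_hyperGrading_zero hm.ne' hn
  dim := (hypDimD_hyper le_rfl hm hn hmn hab).dim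
  normalization := isNoetherNormalization_hyper le_rfl hm
  ass := fun ξ hξ hξm hξ0 => by
    -- A single nonzero `ξ` is a regular sequence of length `d - 1 = 1`.
    have := (hypDimD_hyper le_rfl hm hn hmn hab).ass [⟨ξ, hξ⟩] rfl (by simpa using hξm)
      (isRegular_singleton_subalg _ hm (algebraMap_hyper_injective le_rfl hm)
        algebraMap_hyper hyperParam_mem hξm fun h => hξ0 (congrArg Subtype.val h))
    rwa [List.map_singleton, Ideal.ofList_singleton] at this

end HyperChow

end GradedChow

end

theorem mainTheorem4 {k : Type*} [Field k] [IsAlgClosed k] (d m n a b : ℕ)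
    (hd : 2 ≤ d) (hm : 2 ≤ m) (hn : 2 ≤ n) (hmn : Nat.Coprime m n) (hk : ((m * n : ℕ) : k) ≠ 0)
    (ha : 1 ≤ a) (hb : 1 ≤ b) (hab : a + b = n) :
    IsDomain (GradedChow.HyperRing k d m n a b) ∧
    GradedChow.IsCohenMacaulay (GradedChow.HyperRing k d m n a b) ∧
    ∃ _ : GradedAlgebra (GradedChow.hyperGrading k d m n a b),
      -- the hypotheses of the `d`-dimensional theorem, with `T = k[X, Z, W_3, …, W_d]`
      GradedChow.HypDimD (GradedChow.hyperGrading k d m n a b)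
        (GradedChow.hyperParam k d m n a b) m ∧
      -- the hypotheses of the two-dimensional theorem when `d = 2`
      (∀ h : d = 2, GradedChow.HypDimTwo (GradedChow.hyperGrading k d m n a b)
        (fun i : Fin 2 => GradedChow.hyperParam k d m n a b (Fin.cast h.symm i)) m) ∧
      -- the graded rings `R` with `T ⊆ R ⊆ A`
      ∀ (R : Subalgebra k (GradedChow.HyperRing k d m n a b)) (ℛ : ℕ → Submodule k R)
        [GradedAlgebra ℛ]
        (hTR : GradedChow.subalg k (GradedChow.hyperParam k d m n a b) ≤ R),
        (∀ (i : ℕ) (r : R), r ∈ ℛ i →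
          (r : GradedChow.HyperRing k d m n a b) ∈ GradedChow.hyperGrading k d m n a b i) →
        (((d - 1 : ℕ) : ℕ∞) ≤
            GradedChow.gradeIrrelevant (GradedChow.hyperGrading k d m n a b) hTR →
          IsAddTorsion (GradedChow.GradedChowGroup ℛ 1)) ∧
        (d = 2 → IsAddTorsion (GradedChow.ChowGroup R 1)) := by
  have hm0 : 0 < m := by omega
  have hn0 : n ≠ 0 := by omega
  have hdom : IsDomain (GradedChow.HyperRing k d m n a b) :=
    GradedChow.isDomain_hyper hd hm0 hn0 (by omega) hmn hab
  let inst := GradedChow.hyperGradedAlgebra k m n a b hd hab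
  have hD := GradedChow.hypDimD_hyper (k := k) hd hm0 hn0 hmn hab
  refine ⟨hdom, hD.cohenMacaulay, inst, hD, ?_, ?_⟩
  · rintro rfl
    exact GradedChow.hypDimTwo_hyper hm0 hn0 hmn hab
  · intro R ℛ _ hTR hgr
    have h := GradedChow.isAddTorsion_hyper hd hm0 hmn hab R ℛ hTR hgr
    exact ⟨fun _ => h.1, h.2⟩
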